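/- **Setting.** There are $K$ items and $m$ genres; item $i\in[K]$ has a genre distribution $q_i$ on $[m]$, and $p$ is the target distribution of the user. Lists have a fixed length $k\le K$, and the positions have weights $w_1\ge\dots\ge w_k\ge 0$ with $\sum_j w_j=1$. A list $\pi=\pi_1\cdots\pi_k$ of $k$ distinct items has genre distribution $q(\pi)=\sum_{j=1}^k w_j\,q_{\pi_j}$. An *overlap measure* is a function $G(p,q)$ of distributions $p$ and subdistributions $q$ (nonnegative vectors of total mass at most $1$) such that $G(p,q)\ge 0$ and, for each fixed $p$, $G(p,\cdot)$ is uniquely maximized at $q=p$; it is assumed to be extended to all nonnegative vectors $q$. For $R\subseteq[K]\times[k]$ let $R^{\le j}$ be the set of items $i$ with $(i,\ell)\in R$ for some $\ell\le j$, and $$F_G(R)=G\Bigl(p,\ \sum_{j=1}^k w_j\sum_{i\in R^{\le j}\setminus R^{\le j-1}}q_i\Bigr).$$ $G$ is *strongly monotone diminishing return (SMDR)* for the instance if $F_G$ is monotone and submodular and $G(p',q)$ is non-decreasing in every coordinate of the nonnegative vector $q$, for every distribution $p'$. The *calibration problem* (without repeated items) is to maximize $G(\pi)=G(p,q(\pi))$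 over all lists $\pi$ of $k$ distinct items. **Theorem 4.3.** There is a randomized polynomial-time $(1-1/e)$-approximation algorithm for the calibration problem with distributional genres under any SMDR overlap measure $G$. More precisely, there are one algorithm and one polynomial $T$ such that the following holds for all $K$, $k\le K$, $m$, all instances $(w,(q_i)_i,p)$, and every overlap measure $G$ that is SMDR for the instance. The algorithm is given $K,k,m,w,p,(q_i)_i$ and a value oracle for $q\mapsto G(p,q)$. In every run it makes at most $T(K+k+m)$ steps (elementary operations on integers, exact real arithmetic operations and comparisons, uniformly random integers, and oracle calls) and outputs a list $\bar\pi$ of $k$ distinct items. Its random output satisfies $$\mathbb E\,[G(\bar\pi)]\ \ge\ \Bigl(1-\frac1e\Bigr)\max_\pi G(\pi) \qquad\text{and}\qquad \Pr\Bigl[G(\bar\pi)\ge\Bigl(1-\frac1e\Bigr)\max_\pi G(\pi)\Bigr]\ \ge\ 1-2^{-K},$$ where the maxima are over all lists of $k$ distinct items. -/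

import Mathlib

namespace Calibration

/-! ## Overlap measures and the calibration problem -/

/-- Subdistributions on `m` genres: nonnegative vectors with total mass at most one.
(Distributions are the elements of Mathlib's `stdSimplex ℝ (Fin m)`.) -/
def subdistributions (m : ℕ) : Set (Fin m → ℝ) :=
  {q | (∀ x, 0 ≤ q x) ∧ ∑ x, q x ≤ 1}

/-- `G` is an overlap measure: it is nonnegative on all pairs (distribution, subdistribution), and
for every distribution `p` its unique maximizer among the subdistributions is `p`.
The values of `G p q` for nonnegative `q` of larger mass belong to the extension of `G` that is
needed for the set function below. -/
structure IsOverlapMeasure {m : ℕ} (G : (Fin m → ℝ) → (Fin m → ℝ) → ℝ) : Prop where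
  nonneg : ∀ p ∈ stdSimplex ℝ (Fin m), ∀ q ∈ subdistributions m, 0 ≤ G p q
  unique_max : ∀ p ∈ stdSimplex ℝ (Fin m), ∀ q ∈ subdistributions m, q ≠ p → G p q < G p p

/-- An instance with `K` items, list length `k` and `m` genres: the weights of the positions
(nonnegative, weakly decreasing, with sum one), the genre distribution of every item and the
target distribution of the user. -/
structure Instance (K k m : ℕ) where
  weight : Fin k → ℝ
  genre : Fin K → Fin m → ℝ
  target : Fin m → ℝ
  weight_nonneg : ∀ j, 0 ≤ weight j
  weight_antitone : Antitone weight
  weight_sum : ∑ j, weight j = 1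
  genre_mem : ∀ i, genre i ∈ stdSimplex ℝ (Fin m)
  target_mem : target ∈ stdSimplex ℝ (Fin m)

namespace Instance

variable {K k m : ℕ}

/-- The genre distribution `∑ⱼ wⱼ q_{π j}` of a list `π` of `k` distinct items. -/
def mixture (I : Instance K k m) (π : Fin k ↪ Fin K) : Fin m → ℝ :=
  fun g => ∑ j, I.weight j * I.genre (π j) g

/-- The calibration objective `G(π) = G(p, q(π))`. -/
def value (I : Instance K k m) (G : (Fin m → ℝ) → (Fin m → ℝ) → ℝ) (π : Fin k ↪ Fin K) : ℝ :=
  G I.target (I.mixture π)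

end Instance

/-- The items that a set `R` of item-position pairs puts at position `j` or earlier. -/
def itemsUpTo {K k : ℕ} (R : Finset (Fin K × Fin k)) (j : Fin k) : Finset (Fin K) :=
  {i | ∃ l, l ≤ j ∧ (i, l) ∈ R}

/-- The items that a set `R` of item-position pairs puts strictly before position `j`. -/
def itemsBefore {K k : ℕ} (R : Finset (Fin K × Fin k)) (j : Fin k) : Finset (Fin K) :=
  {i | ∃ l, l < j ∧ (i, l) ∈ R}

/-- The set function `F_G` on sets of item-position pairs, in which every item counts with the
weight of its first position only. -/
def Instance.setValue {K k m : ℕ} (I : Instance K k m) (G : (Fin m → ℝ) → (Fin m → ℝ) → ℝ)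
    (R : Finset (Fin K × Fin k)) : ℝ :=
  G I.target fun g => ∑ j, I.weight j * ∑ i ∈ itemsUpTo R j \ itemsBefore R j, I.genre i g

/-- Monotone diminishing return overlap measures, for the instance `I`: `F_G` is monotone and
submodular. -/
structure IsMDR {K k m : ℕ} (I : Instance K k m) (G : (Fin m → ℝ) → (Fin m → ℝ) → ℝ) : Prop
    extends IsOverlapMeasure G where
  monotone : Monotone (I.setValue G)
  submodular : ∀ R T : Finset (Fin K × Fin k),
    I.setValue G (R ∪ T) + I.setValue G (R ∩ T) ≤ I.setValue G R + I.setValue G T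

/-- Strongly monotone diminishing return overlap measures: in addition, `G(p, q)` is
non-decreasing in every coordinate of the nonnegative vector `q`. -/
structure IsSMDR {K k m : ℕ} (I : Instance K k m) (G : (Fin m → ℝ) → (Fin m → ℝ) → ℝ) : Prop
    extends IsMDR I G where
  nondecreasing : ∀ p ∈ stdSimplex ℝ (Fin m), ∀ q q' : Fin m → ℝ,
    (∀ x, 0 ≤ q x) → (∀ x, q x ≤ q' x) → G p q ≤ G p q'

/-! ## Randomized algorithms over the reals with a value oracle

A structured form of the real random access machine. The memory consists of integer arrays and
real arrays, which have a number as their name and are indexed by pairs of naturals. A program is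
one fixed command, so it names finitely many arrays and its expressions have bounded size. Integers
can only be added, subtracted (truncated at zero) and compared, and reals cannot be rounded to
integers; the only constants are naturals. -/

/-- The state of a computation. Programs cannot access `time`, which counts the steps. -/
structure State where
  nat : ℕ → ℕ → ℕ → ℕ
  real : ℕ → ℕ → ℕ → ℝ
  time : ℕ

/-- Integer expressions; `get a i j` is the entry `(i, j)` of the integer array `a`. -/
inductive NExpr where
  | lit (n : ℕ)
  | get (a : ℕ) (i j : NExpr)
  | add (e f : NExpr)
  | sub (e f : NExpr)

/-- Real expressions; `get a i j` is the entry `(i, j)` of the real array `a`. -/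
inductive RExpr where
  | ofNat (e : NExpr)
  | get (a : ℕ) (i j : NExpr)
  | add (e f : RExpr)
  | sub (e f : RExpr)
  | mul (e f : RExpr)
  | div (e f : RExpr)

/-- Tests. -/
inductive Test where
  | natLT (e f : NExpr)
  | realLT (e f : RExpr)
  | neg (b : Test)
  | conj (b c : Test)

/-- Commands.
* `setNat a i j e`, `setReal a i j e`: assign the value of `e` to the entry `(i, j)` of array `a`;
* `random a i j e`: assign to the entry `(i, j)` of the integer array `a` an independent uniformly
  random integer from `{0, …, e}`;
* `query a i j b r`: assign to the entry `(i, j)` of the real array `a` the answer of the oracle to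
  the vector in row `r` of the real array `b`;
* `loop a e c`: evaluate `e` once, say to `n`, and run `c` for `t = 0, …, n - 1` in this order,
  with `t` written to the entry `(0, 0)` of the integer array `a` before each round. -/
inductive Program where
  | skip
  | setNat (a : ℕ) (i j e : NExpr)
  | setReal (a : ℕ) (i j : NExpr) (e : RExpr)
  | random (a : ℕ) (i j e : NExpr)
  | query (a : ℕ) (i j : NExpr) (b : ℕ) (r : NExpr)
  | seq (c d : Program)
  | cond (b : Test) (c d : Program)
  | loop (a : ℕ) (e : NExpr) (c : Program)

def NExpr.eval (s : State) : NExpr → ℕ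
  | lit n => n
  | get a i j => s.nat a (i.eval s) (j.eval s)
  | add e f => e.eval s + f.eval s
  | sub e f => e.eval s - f.eval s

noncomputable def RExpr.eval (s : State) : RExpr → ℝ
  | ofNat e => (e.eval s : ℝ)
  | get a i j => s.real a (i.eval s) (j.eval s)
  | add e f => e.eval s + f.eval s
  | sub e f => e.eval s - f.eval s
  | mul e f => e.eval s * f.eval s
  | div e f => e.eval s / f.eval s

def Test.Holds (s : State) : Test → Prop
  | natLT e f => e.eval s < f.eval s
  | realLT e f => e.eval s < f.eval s
  | neg b => ¬ b.Holds s
  | conj b c => b.Holds s ∧ c.Holds s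

namespace State

/-- One step passes. -/
def tick (s : State) : State := { s with time := s.time + 1 }

def writeNat (s : State) (a i j v : ℕ) : State :=
  { s with nat := fun a' i' j' => if a' = a ∧ i' = i ∧ j' = j then v else s.nat a' i' j' }

noncomputable def writeReal (s : State) (a i j : ℕ) (v : ℝ) : State :=
  { s with real := fun a' i' j' => if a' = a ∧ i' = i ∧ j' = j then v else s.real a' i' j' }

end State

/-- Run the rounds `0, …, n - 1` of a randomized computation one after the other. -/
noncomputable def rounds (f : ℕ → State → PMF State) : ℕ → State → PMF State
  | 0, s => PMF.pure s
  | n + 1, s => (rounds f n s).bind (f n)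

open Classical in
/-- The distribution of the final state of a program that is started in a given state and has access
to the oracle `O`. Each executed elementary command, test, bound of a loop, and round of a loop
takes one step, besides the steps of the commands that it runs. -/
noncomputable def Program.run (O : (ℕ → ℝ) → ℝ) : Program → State → PMF State
  | skip, s => PMF.pure s.tick
  | setNat a i j e, s => PMF.pure (s.writeNat a (i.eval s) (j.eval s) (e.eval s)).tick
  | setReal a i j e, s => PMF.pure (s.writeReal a (i.eval s) (j.eval s) (e.eval s)).tick
  | random a i j e, s => (PMF.uniformOfFintype (Fin (e.eval s + 1))).map fun v =>
      (s.writeNat a (i.eval s) (j.eval s) v).tick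
  | query a i j b r, s =>
      PMF.pure (s.writeReal a (i.eval s) (j.eval s) (O (s.real b (r.eval s)))).tick
  | seq c d, s => (c.run O s).bind (d.run O)
  | cond b c d, s => if b.Holds s then c.run O s.tick else d.run O s.tick
  | loop a e c, s => rounds (fun t s' => c.run O (s'.writeNat a 0 0 t).tick) (e.eval s) s.tick

namespace Instance

variable {K k m : ℕ}

/-- The initial state: entries `(0, 0)`, `(0, 1)`, `(0, 2)` of the integer array `0` hold
`K`, `k`, `m`; row `0` of the real array `0` holds the weights, row `0` of the real array `1` the
target distribution, and row `i` of the real array `2` the genre distribution of item `i`. All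
other entries are zero. -/
noncomputable def initial (I : Instance K k m) : State where
  nat a i j := if a = 0 ∧ i = 0 then
      (if j = 0 then K else if j = 1 then k else if j = 2 then m else 0) else 0
  real a i j :=
    if a = 0 ∧ i = 0 then (if h : j < k then I.weight ⟨j, h⟩ else 0)
    else if a = 1 ∧ i = 0 then (if h : j < m then I.target ⟨j, h⟩ else 0)
    else if a = 2 then
      (if h : i < K ∧ j < m then I.genre ⟨i, h.1⟩ ⟨j, h.2⟩ else 0)
    else 0
  time := 0

/-- The value oracle for the overlap with the target distribution of the instance: a vector
(of which only the first `m` entries matter) is answered by `G(p, ·)`. -/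
def oracle (I : Instance K k m) (G : (Fin m → ℝ) → (Fin m → ℝ) → ℝ) (v : ℕ → ℝ) : ℝ :=
  G I.target fun g => v g

end Instance

/-- The output of a computation: the first `k` entries of row `0` of the integer array `1`. -/
def State.output (k : ℕ) (s : State) : Fin k → ℕ := fun j => s.nat 1 0 j

end Calibration

/-! Repeated items and empty positions are allowed at first. Such an assignment is a set of
item-position pairs with at most one pair per position, so it is independent in a partition matroid,
and its overlap, with each item counted at its first position only, is `F_G` of that set
(`partialValue_eq_setValue`). Nothing is lost by returning to lists: repeats can be replaced by
unused items such that no occurring item moves behind its first position. As the weights decrease,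
the genre vector grows in every coordinate, and so does `G` by strong monotonicity
(`partialValue_le`, `computes_repair`, `exists_list`). Hence the maximum `M` over assignments is
attained by a list.

The assignment comes from a discrete form of the continuous greedy method. Every position has `n`
slots, and a random assignment uses an independent uniformly random slot at each position; its
expected value is `average`. The slots are filled one at a time, each with the item of largest
empirical mean over random samples. By submodularity a round, which fills one slot per position,
divides the gap between `M` and the average by `1 + 1/n`, up to sampling errors
(`average_round_le`). After `n` rounds the gap is close to `M/e`.

The discretization and sampling errors must be paid for, since the factor `1 - 1/e` is to hold
exactly. Some pair of an optimal list is worth at least `M/K` alone (`exists_valuable_pair`). A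
trial guesses such a pair and puts it into all slots of its position, so that for a right guess the
initial gap is at most `(1 - 1/K) M`. With `n = 24 K³` slots and `n²` samples this leaves an
expected value of at least `(1 - 1/e + 1/(4K)) M` (`ratio_le`, `le_expect_trialValue`).

Values are at most `M`, so the surplus implies that a trial reaches `(1 - 1/e + 1/(8K)) M` with
probability at least `1/(8K³)`, including the probability of the guess (`le_expect_success`). The
best of `n²` independent trials then fails with probability at most `exp(-72 K³)`, and the surplus
`1/(8K)` covers the loss in expectation from failure.

On the program side, `Realizes` presents all randomness of a run as one uniform element of a finite
type, which turns probabilities into finite averages. Running time is bounded by a cost that is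
computed over any semiring, in particular over polynomials. -/

namespace Calibration

/-! ### Composition of uniform random choices -/

section UniformSampling

variable {α β γ : Type} [Fintype α] [Nonempty α] [Fintype β] [Nonempty β]

theorem uniform_bind_uniform_map (g : α → β → γ) :
    ((PMF.uniformOfFintype α).bind fun a => (PMF.uniformOfFintype β).map (g a)) =
      (PMF.uniformOfFintype (α × β)).map fun x => g x.1 x.2 := by
  have h : PMF.uniformOfFintype (α × β) =
      (PMF.uniformOfFintype α).bind fun a => (PMF.uniformOfFintype β).map (Prod.mk a) := by
    ext ⟨a, b⟩
    classical
    rw [PMF.bind_apply, tsum_fintype, Finset.sum_eq_single a]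
    · rw [PMF.map_apply, tsum_fintype, Finset.sum_eq_single b]
      · simp [Fintype.card_prod, ENNReal.mul_inv]
      · intro b' _ hb; simp [hb.symm]
      · simp
    · intro a' _ ha
      rw [PMF.map_apply]
      simp [ha.symm]
    · simp
  rw [h, PMF.map_bind]
  congr 1
  funext a
  rw [PMF.map_comp]
  rfl

theorem uniform_map_equiv (e : α ≃ β) :
    (PMF.uniformOfFintype α).map e = PMF.uniformOfFintype β := by
  classical
  ext b
  rw [PMF.map_apply, tsum_fintype, Finset.sum_eq_single (e.symm b)]
  · simp [Fintype.card_congr e]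
  · intro a _ ha
    have : b ≠ e a := fun h => ha (by simp [h])
    simp [this]
  · simp

theorem uniform_fin_map_congr {a b : ℕ} [NeZero a] [NeZero b] (h : a = b) (g : ℕ → γ) :
    (PMF.uniformOfFintype (Fin a)).map (fun v : Fin a => g v) =
      (PMF.uniformOfFintype (Fin b)).map (fun v : Fin b => g v) := by
  subst h; rfl

end UniformSampling

/-! ### Memory that a program leaves unchanged -/

section Frames

variable {O : (ℕ → ℝ) → ℝ}

@[simp] theorem State.tick_nat (s : State) : s.tick.nat = s.nat := rfl
@[simp] theorem State.tick_real (s : State) : s.tick.real = s.real := rfl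
@[simp] theorem State.tick_time (s : State) : s.tick.time = s.time + 1 := rfl
@[simp] theorem State.writeNat_real (s : State) (a i j v : ℕ) :
    (s.writeNat a i j v).real = s.real := rfl
@[simp] theorem State.writeNat_time (s : State) (a i j v : ℕ) :
    (s.writeNat a i j v).time = s.time := rfl
@[simp] theorem State.writeReal_nat (s : State) (a i j : ℕ) (v : ℝ) :
    (s.writeReal a i j v).nat = s.nat := rfl
@[simp] theorem State.writeReal_time (s : State) (a i j : ℕ) (v : ℝ) :
    (s.writeReal a i j v).time = s.time := rfl

theorem State.writeNat_nat (s : State) (a i j v a' i' j' : ℕ) :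
    (s.writeNat a i j v).nat a' i' j' =
      if a' = a ∧ i' = i ∧ j' = j then v else s.nat a' i' j' := rfl

theorem State.writeReal_real (s : State) (a i j : ℕ) (v : ℝ) (a' i' j' : ℕ) :
    (s.writeReal a i j v).real a' i' j' =
      if a' = a ∧ i' = i ∧ j' = j then v else s.real a' i' j' := rfl

@[simp] theorem State.writeNat_nat_of_ne (s : State) {a a' : ℕ} (i j v : ℕ) (h : a' ≠ a) :
    (s.writeNat a i j v).nat a' = s.nat a' := by
  funext i' j'; simp [State.writeNat, h]

@[simp] theorem State.writeReal_real_of_ne (s : State) {a a' : ℕ} (i j : ℕ) (v : ℝ)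
    (h : a' ≠ a) : (s.writeReal a i j v).real a' = s.real a' := by
  funext i' j'; simp [State.writeReal, h]

@[simp] theorem State.writeNat_nat_self (s : State) (a i j v : ℕ) :
    (s.writeNat a i j v).nat a i j = v := by
  simp [State.writeNat]

@[simp] theorem State.writeReal_real_self (s : State) (a i j : ℕ) (v : ℝ) :
    (s.writeReal a i j v).real a i j = v := by
  simp [State.writeReal]

/-- The integer arrays to which a program may write. -/
def Program.natWrites : Program → Finset ℕ
  | skip => ∅
  | setNat a _ _ _ => {a}
  | setReal _ _ _ _ => ∅
  | random a _ _ _ => {a}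
  | query _ _ _ _ _ => ∅
  | seq c d => c.natWrites ∪ d.natWrites
  | cond _ c d => c.natWrites ∪ d.natWrites
  | loop a _ c => insert a c.natWrites

/-- The real arrays to which a program may write. -/
def Program.realWrites : Program → Finset ℕ
  | skip => ∅
  | setNat _ _ _ _ => ∅
  | setReal a _ _ _ => {a}
  | random _ _ _ _ => ∅
  | query a _ _ _ _ => {a}
  | seq c d => c.realWrites ∪ d.realWrites
  | cond _ c d => c.realWrites ∪ d.realWrites
  | loop _ _ c => c.realWrites

/-- The two states agree on all arrays to which the program does not write. -/
structure Program.Frame (c : Program) (s s' : State) : Prop where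
  nat : ∀ a, a ∉ c.natWrites → s'.nat a = s.nat a
  real : ∀ a, a ∉ c.realWrites → s'.real a = s.real a

theorem rounds_support {f : ℕ → State → PMF State} {n : ℕ} (P : ℕ → State → Prop)
    (hstep : ∀ t < n, ∀ s s', P t s → s' ∈ (f t s).support → P (t + 1) s') {s s' : State}
    (h0 : P 0 s) (hs : s' ∈ (rounds f n s).support) : P n s' := by
  induction n generalizing s' with
  | zero =>
    simp only [rounds, PMF.support_pure, Set.mem_singleton_iff] at hs
    exact hs ▸ h0
  | succ n ih =>
    simp only [rounds, PMF.mem_support_bind_iff] at hs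
    obtain ⟨s₁, h₁, h₂⟩ := hs
    exact hstep n (Nat.lt_succ_self n) _ _
      (ih (fun t ht => hstep t (ht.trans (Nat.lt_succ_self n))) h₁) h₂

theorem Program.frame_of_mem_support {c : Program} {s s' : State}
    (h : s' ∈ (c.run O s).support) : c.Frame s s' := by
  induction c generalizing s s' with
  | skip =>
    simp only [run, PMF.support_pure, Set.mem_singleton_iff] at h
    subst h; exact ⟨fun _ _ => rfl, fun _ _ => rfl⟩
  | setNat a i j e =>
    simp only [run, PMF.support_pure, Set.mem_singleton_iff] at h
    subst h
    refine ⟨fun b hb => ?_, fun _ _ => rfl⟩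
    simp only [natWrites, Finset.mem_singleton] at hb
    simp [hb]
  | setReal a i j e =>
    simp only [run, PMF.support_pure, Set.mem_singleton_iff] at h
    subst h
    refine ⟨fun _ _ => rfl, fun b hb => ?_⟩
    simp only [realWrites, Finset.mem_singleton] at hb
    simp [hb]
  | random a i j e =>
    simp only [run, PMF.support_map, Set.mem_image] at h
    obtain ⟨v, -, rfl⟩ := h
    refine ⟨fun b hb => ?_, fun _ _ => rfl⟩
    simp only [natWrites, Finset.mem_singleton] at hb
    simp [hb]
  | query a i j b r =>
    simp only [run, PMF.support_pure, Set.mem_singleton_iff] at h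
    subst h
    refine ⟨fun _ _ => rfl, fun b hb => ?_⟩
    simp only [realWrites, Finset.mem_singleton] at hb
    simp [hb]
  | seq c d ihc ihd =>
    simp only [run, PMF.mem_support_bind_iff] at h
    obtain ⟨s₁, h₁, h₂⟩ := h
    have hc := ihc h₁
    have hd := ihd h₂
    constructor
    · intro a ha
      simp only [natWrites, Finset.mem_union, not_or] at ha
      rw [hd.nat a ha.2, hc.nat a ha.1]
    · intro a ha
      simp only [realWrites, Finset.mem_union, not_or] at ha
      rw [hd.real a ha.2, hc.real a ha.1]
  | cond b c d ihc ihd =>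
    simp only [run] at h
    split_ifs at h
    · have hc := ihc h
      constructor
      · intro a ha
        simp only [natWrites, Finset.mem_union, not_or] at ha
        exact hc.nat a ha.1
      · intro a ha
        simp only [realWrites, Finset.mem_union, not_or] at ha
        exact hc.real a ha.1
    · have hd := ihd h
      constructor
      · intro a ha
        simp only [natWrites, Finset.mem_union, not_or] at ha
        exact hd.nat a ha.2
      · intro a ha
        simp only [realWrites, Finset.mem_union, not_or] at ha
        exact hd.real a ha.2
  | loop a e c ih =>
    simp only [run] at h
    refine rounds_support (fun _ s₁ => (loop a e c).Frame s s₁) ?_ ?_ h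
    · intro t _ s₁ s₂ h₁ h₂
      have hc := ih h₂
      constructor
      · intro b hb
        have hb' := hb
        simp only [natWrites, Finset.mem_insert, not_or] at hb
        rw [hc.nat b hb.2, State.tick_nat, State.writeNat_nat_of_ne _ _ _ _ hb.1, h₁.nat b hb']
      · intro b hb
        rw [hc.real b hb, ← h₁.real b hb]
        rfl
    · exact ⟨fun _ _ => rfl, fun _ _ => rfl⟩

end Frames

/-! ### Step bounds for programs -/

section Cost

variable {O : (ℕ → ℝ) → ℝ}

/-- The value of a loop bound, if the entries `(0, j)` of the integer array `a` are `v a j`. -/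
def NExpr.bound {S : Type} [Semiring S] (v : ℕ → ℕ → S) : NExpr → S
  | get a _ (lit j) => v a j
  | _ => 0

/-- An upper bound for the number of steps of a program, in terms of the values of the loop
bounds. -/
def Program.cost {S : Type} [Semiring S] (v : ℕ → ℕ → S) : Program → S
  | skip => 1
  | setNat _ _ _ _ => 1
  | setReal _ _ _ _ => 1
  | random _ _ _ _ => 1
  | query _ _ _ _ _ => 1
  | seq c d => c.cost v + d.cost v
  | cond _ c d => 1 + c.cost v + d.cost v
  | loop _ e c => 1 + e.bound v * (1 + c.cost v)

/-- The expression is an entry in row `0` of one of the integer arrays in `B`. -/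
def NExpr.IsCell (B : Finset ℕ) : NExpr → Prop
  | get a (lit 0) (lit _) => a ∈ B
  | _ => False

/-- All loop bounds of the program are entries in row `0` of integer arrays in `B`. -/
def Program.LoopsOver (B : Finset ℕ) : Program → Prop
  | seq c d => c.LoopsOver B ∧ d.LoopsOver B
  | cond _ c d => c.LoopsOver B ∧ d.LoopsOver B
  | loop _ e c => e.IsCell B ∧ c.LoopsOver B
  | _ => True

theorem NExpr.eval_of_isCell {B : Finset ℕ} {e : NExpr} (h : e.IsCell B) {s : State}
    {v : ℕ → ℕ → ℕ} (hv : ∀ a ∈ B, s.nat a 0 = v a) : e.eval s = e.bound v := by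
  match e, h with
  | get a (lit 0) (lit j), h =>
    simp only [IsCell] at h
    simp [eval, bound, hv a h]

/-- The arrays in `B` hold all loop bounds and are never written, so each bound keeps its initial
value wherever its loop occurs, even inside other loops. -/
theorem Program.time_le {B : Finset ℕ} {v : ℕ → ℕ → ℕ} {c : Program} (hl : c.LoopsOver B)
    (hw : Disjoint B c.natWrites) {s s' : State} (hv : ∀ a ∈ B, s.nat a 0 = v a)
    (h : s' ∈ (c.run O s).support) : s'.time ≤ s.time + c.cost v := by
  induction c generalizing s s' with
  | skip | setNat a i j e | setReal a i j e | query a i j b r =>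
    simp only [run, PMF.support_pure, Set.mem_singleton_iff] at h
    subst h; simp [cost]
  | random a i j e =>
    simp only [run, PMF.support_map, Set.mem_image] at h
    obtain ⟨v, -, rfl⟩ := h
    simp [cost]
  | seq c d ihc ihd =>
    simp only [run, PMF.mem_support_bind_iff] at h
    obtain ⟨s₁, h₁, h₂⟩ := h
    simp only [natWrites, Finset.disjoint_union_right] at hw
    have hc := ihc hl.1 hw.1 hv h₁
    have hd := ihd hl.2 hw.2 (s := s₁) (fun a ha => by
      rw [(frame_of_mem_support h₁).nat a (Finset.disjoint_left.1 hw.1 ha), hv a ha]) h₂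
    simp only [cost]
    omega
  | cond b c d ihc ihd =>
    simp only [natWrites, Finset.disjoint_union_right] at hw
    simp only [run] at h
    split_ifs at h
    · have hc := ihc hl.1 hw.1 (s := s.tick) hv h
      simp only [cost, State.tick_time] at hc ⊢
      omega
    · have hd := ihd hl.2 hw.2 (s := s.tick) hv h
      simp only [cost, State.tick_time] at hd ⊢
      omega
  | loop a e c ih =>
    simp only [natWrites, Finset.disjoint_insert_right] at hw
    simp only [run] at h
    rw [NExpr.eval_of_isCell hl.1 hv] at h
    have key := rounds_support (fun t s₁ => (∀ a ∈ B, s₁.nat a 0 = v a) ∧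
      s₁.time ≤ s.time + 1 + t * (1 + c.cost v)) ?_ ?_ h
    · simp only [cost]; omega
    · rintro t - s₁ s₂ ⟨hv₁, ht₁⟩ h₂
      have hv₂ : ∀ b ∈ B, ((s₁.writeNat a 0 0 t).tick).nat b 0 = v b := by
        intro b hb
        have : b ≠ a := fun h => hw.1 (h ▸ hb)
        simp [this, hv₁ b hb]
      refine ⟨fun b hb => ?_, ?_⟩
      · rw [(frame_of_mem_support h₂).nat b (Finset.disjoint_left.1 hw.2 hb), hv₂ b hb]
      · have := ih hl.2 hw.2 hv₂ h₂
        simp only [State.tick_time, State.writeNat_time] at this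
        rw [add_mul, one_mul]
        omega
    · exact ⟨hv, by simp⟩

theorem NExpr.map_bound {S S' : Type} [Semiring S] [Semiring S'] (φ : S →+* S')
    (v : ℕ → ℕ → S) (e : NExpr) : φ (e.bound v) = e.bound fun a j => φ (v a j) := by
  unfold bound; split <;> simp

/-- Evaluation of polynomials is a ring homomorphism. Thus the cost computed at the variable `X` is
a polynomial whose values are the numerical step bounds. -/
theorem Program.map_cost {S S' : Type} [Semiring S] [Semiring S'] (φ : S →+* S')
    (v : ℕ → ℕ → S) (c : Program) : φ (c.cost v) = c.cost fun a j => φ (v a j) := by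
  induction c with
  | skip | setNat | setReal | random | query => simp [cost]
  | seq c d ihc ihd => simp [cost, ihc, ihd]
  | cond b c d ihc ihd => simp [cost, ihc, ihd]
  | loop a e c ih => simp [cost, ih, NExpr.map_bound]

theorem NExpr.bound_mono {v v' : ℕ → ℕ → ℕ} (h : ∀ a j, v a j ≤ v' a j) (e : NExpr) :
    e.bound v ≤ e.bound v' := by
  unfold bound; split
  · exact h _ _
  · exact le_rfl

theorem Program.cost_mono {v v' : ℕ → ℕ → ℕ} (h : ∀ a j, v a j ≤ v' a j) (c : Program) :
    c.cost v ≤ c.cost v' := by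
  induction c with
  | skip | setNat | setReal | random | query => simp [cost]
  | seq c d ihc ihd => simp only [cost]; omega
  | cond b c d ihc ihd => simp only [cost]; omega
  | loop a e c ih =>
    simp only [cost]
    have := NExpr.bound_mono h e
    gcongr

end Cost

/-! ### Rules for deterministic and randomized programs -/

section Specifications

variable {O : (ℕ → ℝ) → ℝ}

/-- Started in `s`, the program makes no random choices and ends in a state with property `Q`. -/
def Computes (O : (ℕ → ℝ) → ℝ) (c : Program) (s : State) (Q : State → Prop) : Prop :=
  ∃ s', c.run O s = PMF.pure s' ∧ Q s'

/-- Started in `s`, the program draws an element `ω` of `Ω` uniformly at random and ends in a state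
that is a function of `ω` and satisfies `Q ω`. -/
def Realizes (O : (ℕ → ℝ) → ℝ) {Ω : Type} [Fintype Ω] [Nonempty Ω] (c : Program) (s : State)
    (Q : Ω → State → Prop) : Prop :=
  ∃ F : Ω → State, c.run O s = (PMF.uniformOfFintype Ω).map F ∧ ∀ ω, Q ω (F ω)

variable {Ω Ω' : Type} [Fintype Ω] [Nonempty Ω] [Fintype Ω'] [Nonempty Ω'] {c d : Program}
  {s : State}

theorem Computes.mono {P Q : State → Prop} (h : Computes O c s P)
    (hPQ : ∀ s', c.Frame s s' → P s' → Q s') : Computes O c s Q := by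
  obtain ⟨s', h₁, h₂⟩ := h
  exact ⟨s', h₁, hPQ s' (Program.frame_of_mem_support (O := O) (by simp [h₁])) h₂⟩

theorem Realizes.mono {P Q : Ω → State → Prop} (h : Realizes O c s P)
    (hPQ : ∀ ω s', c.Frame s s' → P ω s' → Q ω s') : Realizes O c s Q := by
  obtain ⟨F, h₁, h₂⟩ := h
  refine ⟨F, h₁, fun ω => hPQ ω _ (Program.frame_of_mem_support (O := O) ?_) (h₂ ω)⟩
  rw [h₁, PMF.support_map]
  exact ⟨ω, by simp, rfl⟩

theorem computes_skip {Q : State → Prop} (h : Q s.tick) : Computes O .skip s Q :=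
  ⟨_, rfl, h⟩

theorem computes_setNat {Q : State → Prop} {a : ℕ} {i j e : NExpr}
    (h : Q (s.writeNat a (i.eval s) (j.eval s) (e.eval s)).tick) :
    Computes O (.setNat a i j e) s Q := ⟨_, rfl, h⟩

theorem computes_setReal {Q : State → Prop} {a : ℕ} {i j : NExpr} {e : RExpr}
    (h : Q (s.writeReal a (i.eval s) (j.eval s) (e.eval s)).tick) :
    Computes O (.setReal a i j e) s Q := ⟨_, rfl, h⟩

theorem computes_query {Q : State → Prop} {a b : ℕ} {i j r : NExpr}
    (h : Q (s.writeReal a (i.eval s) (j.eval s) (O (s.real b (r.eval s)))).tick) :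
    Computes O (.query a i j b r) s Q := ⟨_, rfl, h⟩

theorem computes_cond {Q : State → Prop} {b : Test} (hc : b.Holds s → Computes O c s.tick Q)
    (hd : ¬ b.Holds s → Computes O d s.tick Q) : Computes O (.cond b c d) s Q := by
  by_cases h : b.Holds s
  · simpa [Computes, Program.run, h] using hc h
  · simpa [Computes, Program.run, h] using hd h

theorem Computes.seq {P Q : State → Prop} (hc : Computes O c s P)
    (hd : ∀ s', c.Frame s s' → P s' → Computes O d s' Q) : Computes O (.seq c d) s Q := by
  obtain ⟨s₁, h₁, hP, hF⟩ := hc.mono (Q := fun s' => P s' ∧ c.Frame s s')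
    (fun s' hF hP => ⟨hP, hF⟩)
  obtain ⟨s₂, h₂, hQ⟩ := hd s₁ hF hP
  exact ⟨s₂, by simp [Program.run, h₁, h₂], hQ⟩

/-- The frame of the entire loop is available in every round, so that an invariant need only mention
arrays that the loop changes. -/
theorem computes_loop {a : ℕ} {e : NExpr} {n : ℕ} (hn : e.eval s = n) (Inv : ℕ → State → Prop)
    (h0 : Inv 0 s.tick)
    (hstep : ∀ t < n, ∀ s', (Program.loop a e c).Frame s s' → Inv t s' →
      Computes O c (s'.writeNat a 0 0 t).tick (Inv (t + 1))) :
    Computes O (.loop a e c) s (Inv n) := by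
  have key : ∀ t ≤ n, ∃ s', rounds (fun t s' => c.run O (s'.writeNat a 0 0 t).tick) t s.tick =
      PMF.pure s' ∧ (Program.loop a e c).Frame s s' ∧ Inv t s' := by
    intro t ht
    induction t with
    | zero => exact ⟨s.tick, rfl, ⟨fun _ _ => rfl, fun _ _ => rfl⟩, h0⟩
    | succ t ih =>
      obtain ⟨s₁, h₁, hF₁, hI₁⟩ := ih (by omega)
      obtain ⟨s₂, h₂, hF₂, hI₂⟩ := (hstep t (by omega) s₁ hF₁ hI₁).mono
        (Q := fun s' => c.Frame (s₁.writeNat a 0 0 t).tick s' ∧ Inv (t + 1) s')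
        (fun s' hF hP => ⟨hF, hP⟩)
      refine ⟨s₂, by simp [rounds, h₁, h₂], ⟨fun b hb => ?_, fun b hb => ?_⟩, hI₂⟩
      · have hb' := hb
        simp only [Program.natWrites, Finset.mem_insert, not_or] at hb
        rw [hF₂.nat b hb.2, State.tick_nat, State.writeNat_nat_of_ne _ _ _ _ hb.1, hF₁.nat b hb']
      · rw [hF₂.real b hb, ← hF₁.real b hb]
        rfl
  obtain ⟨s', h₁, -, h₂⟩ := key n le_rfl
  exact ⟨s', by simp only [Program.run, hn, h₁], h₂⟩

theorem Computes.seq_realizes {P : State → Prop} {Q : Ω → State → Prop} (hc : Computes O c s P)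
    (hd : ∀ s', c.Frame s s' → P s' → Realizes O d s' Q) : Realizes O (.seq c d) s Q := by
  obtain ⟨s₁, h₁, hP, hF⟩ := hc.mono (Q := fun s' => P s' ∧ c.Frame s s')
    (fun s' hF hP => ⟨hP, hF⟩)
  obtain ⟨F, h₂, hQ⟩ := hd s₁ hF hP
  exact ⟨F, by simp [Program.run, h₁, h₂], hQ⟩

theorem Realizes.seq_computes {P Q : Ω → State → Prop} (hc : Realizes O c s P)
    (hd : ∀ ω s', c.Frame s s' → P ω s' → Computes O d s' (Q ω)) :
    Realizes O (.seq c d) s Q := by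
  obtain ⟨F, h₁, hF⟩ := hc.mono (Q := fun ω s' => P ω s' ∧ c.Frame s s')
    (fun ω s' hF hP => ⟨hP, hF⟩)
  choose F' h₂ hQ using fun ω => hd ω (F ω) (hF ω).2 (hF ω).1
  refine ⟨F', ?_, hQ⟩
  rw [Program.run, h₁, PMF.bind_map]
  simp only [Function.comp_def, h₂]
  rfl

/-- The second draw is uniform on the same type whatever the first one was, hence the pair of draws
is uniform on the product. -/
theorem Realizes.seq {P : Ω → State → Prop} {Q : Ω × Ω' → State → Prop} (hc : Realizes O c s P)
    (hd : ∀ ω s', c.Frame s s' → P ω s' → Realizes O d s' fun ω' => Q (ω, ω')) :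
    Realizes O (.seq c d) s Q := by
  obtain ⟨F, h₁, hF⟩ := hc.mono (Q := fun ω s' => P ω s' ∧ c.Frame s s')
    (fun ω s' hF hP => ⟨hP, hF⟩)
  choose F' h₂ hQ using fun ω => hd ω (F ω) (hF ω).2 (hF ω).1
  refine ⟨fun x => F' x.1 x.2, ?_, fun x => hQ x.1 x.2⟩
  rw [Program.run, h₁, PMF.bind_map]
  simp only [Function.comp_def, h₂]
  exact uniform_bind_uniform_map F'

theorem realizes_random {n : ℕ} [NeZero n] {a : ℕ} {i j e : NExpr} (hn : e.eval s + 1 = n)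
    {Q : Fin n → State → Prop}
    (hQ : ∀ v : Fin n, Q v (s.writeNat a (i.eval s) (j.eval s) v).tick) :
    Realizes O (.random a i j e) s Q :=
  ⟨fun v => (s.writeNat a (i.eval s) (j.eval s) v).tick,
    by
      refine Eq.trans ?_
        (uniform_fin_map_congr hn fun v => (s.writeNat a (i.eval s) (j.eval s) v).tick)
      rw [Program.run]
      exact PMF.map_comp (Fin.val) _ _, hQ⟩

/-- The draws of the rounds are collected in a tuple that each round extends by `Fin.snoc`;
independence makes the tuple uniform. The invariant may depend on all draws so far. -/
theorem realizes_loop {a : ℕ} {e : NExpr} {n : ℕ} (hn : e.eval s = n)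
    (Inv : ∀ t : ℕ, (Fin t → Ω) → State → Prop) (h0 : ∀ ω, Inv 0 ω s.tick)
    (hstep : ∀ t < n, ∀ ω s', (Program.loop a e c).Frame s s' → Inv t ω s' →
      Realizes O c (s'.writeNat a 0 0 t).tick
        fun x : Ω => Inv (t + 1) (Fin.snoc (α := fun _ => Ω) ω x)) :
    Realizes O (.loop a e c) s (Inv n) := by
  have key : ∀ t ≤ n, ∃ F : (Fin t → Ω) → State,
      rounds (fun t s' => c.run O (s'.writeNat a 0 0 t).tick) t s.tick =
        (PMF.uniformOfFintype (Fin t → Ω)).map F ∧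
      ∀ ω, (Program.loop a e c).Frame s (F ω) ∧ Inv t ω (F ω) := by
    intro t ht
    induction t with
    | zero =>
      refine ⟨fun _ => s.tick, ?_, fun ω => ⟨⟨fun _ _ => rfl, fun _ _ => rfl⟩, h0 ω⟩⟩
      exact (PMF.map_const _ _).symm
    | succ t ih =>
      obtain ⟨F, h₁, hF⟩ := ih (by omega)
      choose F' h₂ hQ using fun ω => (hstep t (by omega) ω (F ω) (hF ω).1 (hF ω).2).mono
        (Q := fun x s' => c.Frame ((F ω).writeNat a 0 0 t).tick s' ∧
          Inv (t + 1) (Fin.snoc (α := fun _ => Ω) ω x) s')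
        (fun ω s' hF hP => ⟨hF, hP⟩)
      let E : (Fin t → Ω) × Ω ≃ (Fin (t + 1) → Ω) :=
        (Equiv.prodComm _ _).trans (Fin.snocEquiv fun _ => Ω)
      refine ⟨fun ω => F' (E.symm ω).1 (E.symm ω).2, ?_, fun ω => ?_⟩
      · rw [rounds, h₁, PMF.bind_map]
        simp only [Function.comp_def, h₂]
        rw [uniform_bind_uniform_map F', ← uniform_map_equiv E, PMF.map_comp]
        congr 1
        funext x
        simp
      · have hω : Fin.snoc (α := fun _ => Ω) (E.symm ω).1 (E.symm ω).2 = ω :=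
          E.apply_symm_apply ω
        obtain ⟨hF₂, hI₂⟩ := hQ (E.symm ω).1 (E.symm ω).2
        rw [hω] at hI₂
        refine ⟨⟨fun b hb => ?_, fun b hb => ?_⟩, hI₂⟩
        · have hb' := hb
          simp only [Program.natWrites, Finset.mem_insert, not_or] at hb
          rw [hF₂.nat b hb.2, State.tick_nat, State.writeNat_nat_of_ne _ _ _ _ hb.1,
            (hF _).1.nat b hb']
        · rw [hF₂.real b hb, ← (hF _).1.real b hb]
          rfl
  obtain ⟨F, h₁, h₂⟩ := key n le_rfl
  exact ⟨F, by simp only [Program.run, hn, h₁], fun ω => (h₂ ω).2⟩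

end Specifications

/-- The entry `(0, 0)` of an integer array. -/
abbrev NExpr.cell (a : ℕ) : NExpr := .get a (.lit 0) (.lit 0)

/-- An entry in row `0` of an integer array. -/
abbrev NExpr.entry (a : ℕ) (j : NExpr) : NExpr := .get a (.lit 0) j

/-- An entry in row `0` of a real array. -/
abbrev RExpr.entry (a : ℕ) (j : NExpr) : RExpr := .get a (.lit 0) j

/-- The numbers of items, positions and genres. -/
abbrev NExpr.items : NExpr := .get 0 (.lit 0) (.lit 0)
abbrev NExpr.positions : NExpr := .get 0 (.lit 0) (.lit 1)
abbrev NExpr.genres : NExpr := .get 0 (.lit 0) (.lit 2)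

/-! ### Assignments with repeated items and empty positions -/

section Model

variable {K k m : ℕ}

/-- The genre distribution of an item, and zero for numbers that are not items. -/
def Instance.item (I : Instance K k m) (x : ℕ) (g : Fin m) : ℝ :=
  if h : x < K then I.genre ⟨x, h⟩ g else 0

/-- The genre vector of an assignment of items to positions, possibly with repeated items and with
empty positions (those with a number that is not an item). -/
noncomputable def Instance.partialMixture (I : Instance K k m) (a : Fin k → ℕ) (g : Fin m) : ℝ :=
  ∑ l, if ∃ l' < l, a l' = a l then 0 else I.weight l * I.item (a l) g

/-- The overlap of an assignment of items to positions. -/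
noncomputable def Instance.partialValue (I : Instance K k m)
    (G : (Fin m → ℝ) → (Fin m → ℝ) → ℝ) (a : Fin k → ℕ) : ℝ :=
  G I.target (I.partialMixture a)

theorem sum_ite_lt_succ {M : Type} [AddCommMonoid M] (φ : Fin k → M) {t : ℕ} (ht : t < k) :
    (∑ l : Fin k, if (l : ℕ) < t + 1 then φ l else 0) =
      (∑ l : Fin k, if (l : ℕ) < t then φ l else 0) + φ ⟨t, ht⟩ := by
  have h : ∀ l : Fin k, (if (l : ℕ) < t + 1 then φ l else 0) =
      (if (l : ℕ) < t then φ l else 0) + if l = ⟨t, ht⟩ then φ l else 0 := by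
    intro l
    rcases lt_trichotomy (l : ℕ) t with h | h | h
    · simp [h, h.trans (Nat.lt_succ_self t), Fin.ext_iff, h.ne]
    · obtain rfl : l = ⟨t, ht⟩ := Fin.ext h
      simp
    · simp [h.not_gt, Fin.ext_iff, h.ne', show ¬ (l : ℕ) < t + 1 by omega]
  simp_rw [h, Finset.sum_add_distrib]
  simp

end Model

/-- The arrays `0`, `10`, `11` (integers) and `0`, `2` (reals) hold the sizes and weights of the
instance, the number `n` of slots, and the number `N` of samples. -/
structure Loaded {K k m : ℕ} (I : Instance K k m) (n N : ℕ) (s : State) : Prop where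
  items : s.nat 0 0 0 = K
  positions : s.nat 0 0 1 = k
  genres : s.nat 0 0 2 = m
  slots : s.nat 10 0 0 = n
  samples : s.nat 11 0 0 = N
  weight : ∀ l : Fin k, s.real 0 0 l = I.weight l
  genre : ∀ (x : ℕ) (g : Fin m), s.real 2 x g = I.item x g

/-- The program preserves `Loaded`. -/
def Program.Safe (c : Program) : Prop :=
  (0 ∉ c.natWrites ∧ 10 ∉ c.natWrites ∧ 11 ∉ c.natWrites) ∧ 0 ∉ c.realWrites ∧ 2 ∉ c.realWrites

instance (c : Program) : Decidable c.Safe := by unfold Program.Safe; infer_instance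

section

variable {K k m n N : ℕ} {I : Instance K k m} {s s' : State}

theorem Loaded.frame (h : Loaded I n N s) {c : Program} (hc : c.Frame s s') (hs : c.Safe) :
    Loaded I n N s' := by
  obtain ⟨⟨h0, h10, h11⟩, r0, r2⟩ := hs
  constructor
  · rw [hc.nat _ h0, h.items]
  · rw [hc.nat _ h0, h.positions]
  · rw [hc.nat _ h0, h.genres]
  · rw [hc.nat _ h10, h.slots]
  · rw [hc.nat _ h11, h.samples]
  · intro l; rw [hc.real _ r0, h.weight]
  · intro x g; rw [hc.real _ r2, h.genre]

theorem Loaded.tick (h : Loaded I n N s) : Loaded I n N s.tick := ⟨h.1, h.2, h.3, h.4, h.5, h.6, h.7⟩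

theorem Loaded.writeNat (h : Loaded I n N s) {a : ℕ} (i j v : ℕ)
    (ha : a ≠ 0 ∧ a ≠ 10 ∧ a ≠ 11) : Loaded I n N (s.writeNat a i j v).tick := by
  obtain ⟨h0, h10, h11⟩ := ha
  constructor <;> simp [h0.symm, h10.symm, h11.symm, h.items, h.positions, h.genres, h.slots,
    h.samples, h.weight, h.genre]

theorem Loaded.writeReal (h : Loaded I n N s) {a : ℕ} (i j : ℕ) (v : ℝ)
    (ha : a ≠ 0 ∧ a ≠ 2) : Loaded I n N (s.writeReal a i j v).tick := by
  obtain ⟨h0, h2⟩ := ha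
  constructor <;> simp [h0.symm, h2.symm, h.items, h.positions, h.genres, h.slots,
    h.samples, h.weight, h.genre]

end

/-! ### Evaluating an assignment -/

namespace Algorithm

/-- The assignment of items to positions in the integer array `3`. -/
def assignment (k : ℕ) (s : State) (l : Fin k) : ℕ := s.nat 3 0 l

/-- Accumulate the genre vector of the assignment in the real array `3`; the integer array `4` marks
the items that have occurred. -/
def accumulate : Program :=
  .loop 22 .positions
    (.cond (.natLT (.entry 4 (.entry 3 (.cell 22))) (.lit 1))
      (.seq (.setNat 4 (.lit 0) (.entry 3 (.cell 22)) (.lit 1))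
        (.loop 23 .genres
          (.setReal 3 (.lit 0) (.cell 23)
            (.add (.entry 3 (.cell 23))
              (.mul (.entry 0 (.cell 22)) (.get 2 (.entry 3 (.cell 22)) (.cell 23)))))))
      .skip)

/-- Remove all marks of items. -/
def unmark : Program := .loop 21 .items (.setNat 4 (.lit 0) (.cell 21) (.lit 0))

/-- Write the overlap of the assignment to the real array `4`. -/
def evaluate : Program :=
  .seq (.loop 20 .genres (.setReal 3 (.lit 0) (.cell 20) (.ofNat (.lit 0))))
    (.seq unmark (.seq accumulate (.query 4 (.lit 0) (.lit 0) 3 (.lit 0))))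

variable {K k m n N : ℕ} {I : Instance K k m} {s : State} {O : (ℕ → ℝ) → ℝ}

theorem computes_unmark (h : Loaded I n N s) :
    Computes O unmark s fun s' => ∀ x < K, s'.nat 4 0 x = 0 := by
  refine computes_loop (n := K) (by exact h.items) (fun t s' => ∀ x < t, s'.nat 4 0 x = 0) (by simp) ?_
  intro t _ s₁ hF hI
  refine computes_setNat fun x hx => ?_
  simp only [NExpr.eval, State.tick_nat, State.writeNat_nat_self, State.writeNat_nat, true_and]
  split_ifs with h1 h2
  · rfl
  · omega
  · exact hI x (by omega)

/-- An item is unmarked exactly when it has not occurred at an earlier position, so the test selects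
the nonzero terms of `partialMixture`. The invariant speaks of marks below `K` only: the number `K`
of an empty position may carry a stale mark. -/
theorem computes_accumulate (h : Loaded I n N s) (h4 : ∀ x < K, s.nat 4 0 x = 0)
    (h3 : ∀ g : Fin m, s.real 3 0 g = 0) :
    Computes O accumulate s fun s' =>
      ∀ g : Fin m, s'.real 3 0 g = I.partialMixture (assignment k s) g := by
  set a := assignment k s with ha
  refine (computes_loop (n := k) (by exact h.positions) (fun t s' =>
    (∀ x < K, s'.nat 4 0 x = 0 ↔ ∀ l : Fin k, (l : ℕ) < t → a l ≠ x) ∧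
    ∀ g : Fin m, s'.real 3 0 g = ∑ l : Fin k, if (l : ℕ) < t then
      (if ∃ l' < l, a l' = a l then 0 else I.weight l * I.item (a l) g) else 0) ?_ ?_).mono ?_
  · simp only [State.tick_nat, State.tick_real]
    exact ⟨fun x hx => by simp [h4 x hx], fun g => by simp [h3 g]⟩
  · rintro t ht s₁ hF ⟨hu, hv⟩
    have hL := (h.frame hF (by decide)).writeNat (a := 22) 0 0 t (by decide)
    have ha₁ : s₁.nat 3 0 t = a ⟨t, ht⟩ := by rw [hF.nat 3 (by decide)]; rfl
    have hw : s₁.real 0 0 t = I.weight ⟨t, ht⟩ := (h.frame hF (by decide)).weight ⟨t, ht⟩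
    have hq : ∀ g : Fin m, s₁.real 2 (a ⟨t, ht⟩) g = I.item (a ⟨t, ht⟩) g :=
      (h.frame hF (by decide)).genre _
    have hstep := fun g => sum_ite_lt_succ (fun l : Fin k =>
      if ∃ l' < l, a l' = a l then 0 else I.weight l * I.item (a l) g) ht
    refine computes_cond (fun hb => ?_) (fun hb => ?_)
    · simp only [Test.Holds, NExpr.eval, State.tick_nat, State.writeNat_nat_self, ha₁,
        ne_eq, Nat.reduceEqDiff, not_false_eq_true,
        State.writeNat_nat_of_ne, Nat.lt_one_iff] at hb
      refine Computes.seq (computes_setNat (Q := fun s' => s'.nat 4 0 (a ⟨t, ht⟩) = 1 ∧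
        (∀ x, x ≠ a ⟨t, ht⟩ → s'.nat 4 0 x = s₁.nat 4 0 x) ∧ s'.real = s₁.real ∧
        s'.nat 3 0 t = a ⟨t, ht⟩ ∧ s'.nat 0 = s₁.nat 0 ∧ s'.nat 22 0 0 = t) ?_) ?_
      · simp +contextual [NExpr.eval, ha₁, State.writeNat_nat]
      · rintro s₂ - ⟨h4₂, h4₂', hr, h3₂, h0₂, h22⟩
        refine (computes_loop (n := m)
          (by simp [NExpr.eval, h0₂, (h.frame hF (by decide)).genres])
          (fun u s' => ∀ g : Fin m, s'.real 3 0 g = s₁.real 3 0 g +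
            if (g : ℕ) < u then I.weight ⟨t, ht⟩ * I.item (a ⟨t, ht⟩) g else 0) ?_ ?_).mono ?_
        · simp [hr]
        · intro u hu s₃ hF₃ hI
          refine computes_setReal fun g => ?_
          have e1 : s₃.nat 22 0 0 = t := by rw [hF₃.nat 22 (by decide), h22]
          have e2 : s₃.nat 3 0 t = a ⟨t, ht⟩ := by rw [hF₃.nat 3 (by decide), h3₂]
          have e3 : s₃.real 0 0 t = I.weight ⟨t, ht⟩ := by rw [hF₃.real 0 (by decide), hr, hw]
          have e4 : s₃.real 2 (a ⟨t, ht⟩) u = I.item (a ⟨t, ht⟩) ⟨u, hu⟩ := by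
            rw [hF₃.real 2 (by decide), hr]; exact hq ⟨u, hu⟩
          have e5 := hI ⟨u, hu⟩
          simp only [lt_irrefl, if_false, add_zero] at e5
          simp only [NExpr.eval, RExpr.eval, State.tick_nat, State.tick_real,
            State.writeNat_nat_self, State.writeNat_real, State.writeReal_real, true_and,
            ne_eq, Nat.reduceEqDiff, not_false_eq_true,
            State.writeNat_nat_of_ne, e1, e2, e3, e4, e5, hI g]
          rcases lt_trichotomy (g : ℕ) u with h | h | h
          · simp [h.ne, h, h.trans (Nat.lt_succ_self u)]
          · obtain rfl : g = ⟨u, hu⟩ := Fin.ext h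
            simp
          · simp [h.ne', h.not_gt, show ¬ (g : ℕ) < u + 1 by omega]
        · intro s₃ hF₃ hv₃
          have h4₃ : s₃.nat 4 = s₂.nat 4 := hF₃.nat 4 (by decide)
          refine ⟨fun x hx => ?_, fun g => ?_⟩
          · rw [h4₃]
            by_cases hxa : x = a ⟨t, ht⟩
            · subst hxa
              simp only [h4₂, one_ne_zero, false_iff, not_forall]
              exact ⟨⟨t, ht⟩, Nat.lt_succ_self t, fun h => h rfl⟩
            · rw [h4₂' x hxa, hu x hx]
              refine ⟨fun h l hl => ?_, fun h l hl => h l (by omega)⟩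
              rcases Nat.lt_succ_iff_lt_or_eq.1 hl with hl | hl
              · exact h l hl
              · obtain rfl : l = ⟨t, ht⟩ := Fin.ext hl
                exact fun h => hxa h.symm
          · rw [hstep g, hv₃ g, hv g]
            simp only [g.isLt, if_true]
            congr 1
            -- For a number that is not an item the mark carries no information, but its genre
            -- vector is zero and both sides agree.
            by_cases hK : a ⟨t, ht⟩ < K
            · rw [if_neg]
              rintro ⟨l', hl', he⟩
              exact (hu _ hK).1 hb l' hl' he
            · simp [Instance.item, hK]
    · simp only [Test.Holds, NExpr.eval, State.tick_nat, State.writeNat_nat_self, ha₁,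
        ne_eq, Nat.reduceEqDiff, not_false_eq_true,
        State.writeNat_nat_of_ne, Nat.lt_one_iff] at hb
      refine computes_skip ⟨fun x hx => ?_, fun g => ?_⟩
      · simp only [State.tick_nat, ne_eq, Nat.reduceEqDiff,
          not_false_eq_true, State.writeNat_nat_of_ne, hu x hx]
        refine ⟨fun h l hl => ?_, fun h l hl => h l (by omega)⟩
        rcases Nat.lt_succ_iff_lt_or_eq.1 hl with hl | hl
        · exact h l hl
        · obtain rfl : l = ⟨t, ht⟩ := Fin.ext hl
          rintro rfl
          exact hb ((hu _ hx).2 h)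
      · simp only [State.tick_real, State.writeNat_real, hv g, hstep g, left_eq_add]
        by_cases hK : a ⟨t, ht⟩ < K
        · rw [if_pos]
          by_contra hne
          push Not at hne
          exact hb ((hu _ hK).2 fun l hl => hne l hl)
        · simp [Instance.item, hK]
  · rintro s' - ⟨-, hv⟩ g
    rw [hv g]
    simp [Instance.partialMixture]

theorem computes_evaluate {G : (Fin m → ℝ) → (Fin m → ℝ) → ℝ} (h : Loaded I n N s) :
    Computes (I.oracle G) evaluate s fun s' =>
      s'.real 4 0 0 = I.partialValue G (assignment k s) := by
  refine Computes.seq (computes_loop (n := m) (by exact h.genres)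
    (fun u s' => ∀ g : Fin m, (g : ℕ) < u → s'.real 3 0 g = 0) (by simp) ?_) ?_
  · intro u hu s₁ hF hI
    refine computes_setReal fun g hg => ?_
    simp only [NExpr.eval, RExpr.eval, State.tick_nat, State.tick_real, Nat.cast_zero,
      State.writeNat_nat_self, State.writeNat_real, State.writeReal_real, true_and]
    split_ifs with h1
    · rfl
    · exact hI g (by omega)
  intro s₁ hF₁ h₁
  have hL₁ := h.frame hF₁ (by decide)
  refine Computes.seq (computes_unmark hL₁) fun s₂ hF₂ h₂ => ?_
  have hL₂ := hL₁.frame hF₂ (by decide)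
  refine Computes.seq (computes_accumulate hL₂ h₂ fun g => ?_) fun s₃ hF₃ h₃ => ?_
  · rw [hF₂.real 3 (by decide)]; exact h₁ g g.isLt
  refine computes_query ?_
  have ha : assignment k s₂ = assignment k s := by
    funext l
    simp only [assignment]
    rw [hF₂.nat 3 (by decide), hF₁.nat 3 (by decide)]
  simp only [NExpr.eval, State.tick_real, State.writeReal_real_self, Instance.oracle,
    Instance.partialValue, ← ha]
  congr 1
  funext g
  exact h₃ g

/-! ### Filling the table of slots -/

/-- A table with `n` slots for each position. -/
abbrev Table (n k : ℕ) := Fin n → Fin k → ℕ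

/-- The assignment that uses the slot `x l` of every position `l`. -/
def pick {n k : ℕ} (T : Table n k) (x : Fin k → Fin n) (l : Fin k) : ℕ := T (x l) l

/-- As `pick`, but with item `i` at position `j`. -/
def pickWith {n k : ℕ} (T : Table n k) (x : Fin k → Fin n) (j i : ℕ) (l : Fin k) : ℕ :=
  if (l : ℕ) = j then i else T (x l) l

/-- Fill slot `t` of position `j` with item `i`. -/
def Table.set {n k : ℕ} (T : Table n k) (t j i : ℕ) : Table n k :=
  fun t' l => if (t' : ℕ) = t ∧ (l : ℕ) = j then i else T t' l

/-- The first maximizer of a function among the numbers below a bound. -/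
noncomputable def argmaxBelow (f : ℕ → ℝ) : ℕ → ℕ
  | 0 => 0
  | t + 1 => if f (argmaxBelow f t) < f t then t else argmaxBelow f t

theorem argmaxBelow_lt (f : ℕ → ℝ) {t : ℕ} (ht : 0 < t) : argmaxBelow f t < t := by
  induction t with
  | zero => omega
  | succ t ih =>
    simp only [argmaxBelow]
    split_ifs
    · omega
    · rcases Nat.eq_zero_or_pos t with rfl | h
      · simp [argmaxBelow]
      · exact (ih h).trans (Nat.lt_succ_self t)

theorem le_argmaxBelow (f : ℕ → ℝ) {t i : ℕ} (hi : i < t) : f i ≤ f (argmaxBelow f t) := by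
  induction t with
  | zero => omega
  | succ t ih =>
    simp only [argmaxBelow]
    rcases Nat.lt_succ_iff_lt_or_eq.1 hi with h | rfl
    · split_ifs with h'
      · exact (ih h).trans h'.le
      · exact ih h
    · split_ifs with h'
      · exact le_rfl
      · exact not_lt.1 h'

/-- The real array in memory is known to agree with the estimates on items only. Positivity of `K`
is needed because the default candidate `0` is compared as well. -/
theorem argmaxBelow_congr {f g : ℕ → ℝ} {K : ℕ} (hK : 0 < K) (h : ∀ i < K, f i = g i) {t : ℕ}
    (ht : t ≤ K) : argmaxBelow f t = argmaxBelow g t := by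
  induction t with
  | zero => rfl
  | succ t ih =>
    have ih := ih (by omega)
    have hlt : argmaxBelow g t < K := by
      rcases Nat.eq_zero_or_pos t with rfl | h
      · exact hK
      · exact (argmaxBelow_lt g h).trans_le (by omega)
    simp only [argmaxBelow, ih, h _ hlt, h t ht]

/-- Apply randomized updates with the random elements `ω 0, …, ω (t - 1)` in this order. -/
def fold {β Ω : Type} (f : ℕ → β → Ω → β) : (t : ℕ) → β → (Fin t → Ω) → β
  | 0, b, _ => b
  | t + 1, b, ω => f t (fold f t b fun r => ω r.castSucc) (ω (Fin.last t))

theorem fold_snoc {β Ω : Type} (f : ℕ → β → Ω → β) (t : ℕ) (b : β) (ω : Fin t → Ω) (x : Ω) :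
    fold f (t + 1) b (Fin.snoc (α := fun _ => Ω) ω x) = f t (fold f t b ω) x := by
  simp [fold]

section

variable {K k m n N : ℕ} (I : Instance K k m) (G : (Fin m → ℝ) → (Fin m → ℝ) → ℝ)

/-- The total overlap, over the samples, with item `i` at position `j`. -/
noncomputable def estimate (T : Table n k) (j : ℕ) (ω : Fin N → Fin k → Fin n) (i : ℕ) : ℝ :=
  ∑ r, I.partialValue G (pickWith T (ω r) j i)

/-- Fill slot `t` of position `j` with the item that looks best, unless `j` is the guessed position
`jstar`. -/
noncomputable def step (jstar t j : ℕ) (T : Table n k) (ω : Fin N → Fin k → Fin n) : Table n k :=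
  if j = jstar then T else T.set t j (argmaxBelow (estimate I G T j ω) K)

/-- The initial table for a guessed item and a guessed position. -/
def start (K n k : ℕ) (p : Fin K × Fin k) : Table n k :=
  fun _ l => if l = p.2 then p.1 else K

/-- The table after all rounds. -/
noncomputable def finalTable (n : ℕ) (p : Fin K × Fin k)
    (ω : Fin n → Fin k → Fin N → Fin k → Fin n) : Table n k :=
  fold (fun t => fold (step I G p.2 t) k) n (start K n k p) ω

end

/-- The table in the integer array `2`. -/
def table (n k : ℕ) (s : State) : Table n k := fun t l => s.nat 2 t l

def sample : Program := .loop 24 .positions (.random 5 (.lit 0) (.cell 24) (.sub (.cell 10) (.lit 1)))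

def assign : Program :=
  .loop 25 .positions (.setNat 3 (.lit 0) (.cell 25) (.get 2 (.entry 5 (.cell 25)) (.cell 25)))

/-- Evaluate all items at the position in register `31`, with a fresh sample for the other
positions. -/
def tryItems : Program :=
  .loop 26 .items (.seq assign (.seq (.setNat 3 (.lit 0) (.cell 31) (.cell 26))
    (.seq evaluate (.setReal 5 (.lit 0) (.cell 26)
      (.add (.entry 5 (.cell 26)) (.get 4 (.lit 0) (.lit 0)))))))

def addSamples : Program :=
  .seq (.loop 27 .items (.setReal 5 (.lit 0) (.cell 27) (.ofNat (.lit 0))))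
    (.loop 28 (.cell 11) (.seq sample tryItems))

def findBest : Program :=
  .seq (.setNat 8 (.lit 0) (.lit 0) (.lit 0))
    (.loop 29 .items (.cond (.realLT (.entry 5 (.cell 8)) (.entry 5 (.cell 29)))
      (.setNat 8 (.lit 0) (.lit 0) (.cell 29)) .skip))

abbrev equal (e f : NExpr) : Test := .conj (.neg (.natLT e f)) (.neg (.natLT f e))

def fillEntry : Program :=
  .seq addSamples (.seq findBest
    (.cond (equal (.cell 31) (.cell 7)) .skip (.setNat 2 (.cell 30) (.cell 31) (.cell 8))))

def fillTable : Program := .loop 30 (.cell 10) (.loop 31 .positions fillEntry)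

def resetTable : Program :=
  .loop 32 (.cell 10) (.loop 33 .positions (.cond (equal (.cell 33) (.cell 7))
    (.setNat 2 (.cell 32) (.cell 33) (.cell 6)) (.setNat 2 (.cell 32) (.cell 33) .items)))

def guess : Program :=
  .seq (.random 6 (.lit 0) (.lit 0) (.sub .items (.lit 1)))
    (.random 7 (.lit 0) (.lit 0) (.sub .positions (.lit 1)))

variable {K k m n N : ℕ} {I : Instance K k m} {G : (Fin m → ℝ) → (Fin m → ℝ) → ℝ} {s : State}
  {O : (ℕ → ℝ) → ℝ} {T : Table n k}

theorem realizes_sample [NeZero n] (h : Loaded I n N s) :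
    Realizes O (Ω := Fin k → Fin n) sample s fun x s' => ∀ l : Fin k, s'.nat 5 0 l = x l := by
  refine realizes_loop (n := k) (by exact h.positions)
    (fun t (x : Fin t → Fin n) s' => ∀ l : Fin t, s'.nat 5 0 l = x l) (fun _ l => l.elim0) ?_
  intro t ht x s₁ hF hI
  have h10 := (h.frame hF (by decide)).slots
  have hn := NeZero.pos n
  refine realizes_random (by simp [NExpr.eval, h10]; omega) fun v l => ?_
  refine Fin.lastCases ?_ (fun l => ?_) l
  · simp [NExpr.eval]
  · have := l.isLt
    simp [NExpr.eval, State.writeNat_nat, this.ne, hI l]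

theorem computes_assign (h : Loaded I n N s) (hT : table n k s = T) {x : Fin k → Fin n}
    (hx : ∀ l : Fin k, s.nat 5 0 l = x l) :
    Computes O assign s fun s' => assignment k s' = pick T x := by
  refine (computes_loop (n := k) (by exact h.positions)
    (fun t s' => ∀ l : Fin k, (l : ℕ) < t → s'.nat 3 0 l = pick T x l) (by simp) ?_).mono ?_
  · intro t ht s₁ hF hI
    refine computes_setNat fun l hl => ?_
    have h5 : s₁.nat 5 0 t = x ⟨t, ht⟩ := by
      rw [hF.nat 5 (by decide)]; exact hx ⟨t, ht⟩
    have h2 : s₁.nat 2 (x ⟨t, ht⟩) t = pick T x ⟨t, ht⟩ := by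
      rw [hF.nat 2 (by decide), pick, ← hT]; rfl
    simp only [NExpr.eval, State.tick_nat, State.writeNat_nat, true_and,
      and_self, if_true, Nat.reduceEqDiff, false_and, if_false, h5, h2]
    split_ifs with h1
    · obtain rfl : l = ⟨t, ht⟩ := Fin.ext h1
      rfl
    · exact hI l (by omega)
  · intro s' _ h'
    funext l
    exact h' l l.isLt

theorem computes_tryItems {j : ℕ} (h : Loaded I n N s) (hT : table n k s = T)
    (h31 : s.nat 31 0 0 = j) {x : Fin k → Fin n} (hx : ∀ l : Fin k, s.nat 5 0 l = x l) :
    Computes (I.oracle G) tryItems s fun s' => ∀ i < K,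
      s'.real 5 0 i = s.real 5 0 i + I.partialValue G (pickWith T x j i) := by
  refine (computes_loop (n := K) (by exact h.items)
    (fun t s' => ∀ i < K, s'.real 5 0 i = s.real 5 0 i +
      if i < t then I.partialValue G (pickWith T x j i) else 0) (by simp) ?_).mono ?_
  · intro t ht s₁ hF hI
    have hL₁ := (h.frame hF (by decide)).writeNat (a := 26) 0 0 t (by decide)
    refine Computes.seq (computes_assign hL₁ (T := T) (x := x) ?_ ?_) fun s₂ hF₂ h₂ => ?_
    · rw [← hT]; funext t' l
      simp [table, hF.nat 2 (by decide)]
    · intro l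
      simp [hF.nat 5 (by decide), hx l]
    have hL₂ := hL₁.frame hF₂ (by decide)
    have h26 : s₂.nat 26 0 0 = t := by rw [hF₂.nat 26 (by decide)]; simp
    have h31' : s₂.nat 31 0 0 = j := by
      rw [hF₂.nat 31 (by decide)]; simp [hF.nat 31 (by decide), h31]
    refine Computes.seq (computes_setNat (Q := fun s' => Loaded I n N s' ∧
      assignment k s' = pickWith T x j t) ⟨hL₂.writeNat _ _ _ (by decide), ?_⟩) ?_
    · funext l
      have : s₂.nat 3 0 l = pick T x l := congrFun h₂ l
      simp [assignment, NExpr.eval, h31', h26, State.writeNat_nat, this, pickWith, pick]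
    rintro s₃ hF₃ ⟨hL₃, h₃⟩
    refine Computes.seq (computes_evaluate hL₃) fun s₄ hF₄ h₄ => ?_
    rw [h₃] at h₄
    have h26' : s₄.nat 26 0 0 = t := by
      rw [hF₄.nat 26 (by decide), hF₃.nat 26 (by decide), h26]
    have h5 : s₄.real 5 = s₁.real 5 := by
      rw [hF₄.real 5 (by decide), hF₃.real 5 (by decide), hF₂.real 5 (by decide)]; rfl
    refine computes_setReal fun i hi => ?_
    simp only [NExpr.eval, RExpr.eval, State.tick_real, State.writeReal_real, true_and, h26', h5,
      h₄]
    split_ifs with h1 h2 h3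
    · subst h1
      rw [hI i hi]; simp
    · omega
    · rw [hI i hi, if_pos (by omega)]
    · rw [hI i hi, if_neg (by omega)]
  · intro s' _ h' i hi
    rw [h' i hi, if_pos hi]

/-- One sample of slots serves all items, so the estimates of different items are dependent. This is
harmless: the error analysis adds up the deviations of the single items and needs independence only
between samples. -/
theorem realizes_addSamples [NeZero n] {j : ℕ} (h : Loaded I n N s)
    (hT : table n k s = T) (h31 : s.nat 31 0 0 = j) :
    Realizes (I.oracle G) (Ω := Fin N → Fin k → Fin n) addSamples s
      fun ω s' => ∀ i < K, s'.real 5 0 i = estimate I G T j ω i := by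
  refine Computes.seq_realizes (computes_loop (n := K) (by exact h.items)
    (fun u s' => ∀ i < u, s'.real 5 0 i = 0) (by simp) ?_) ?_
  · intro u hu s₁ hF hI
    refine computes_setReal fun i hi => ?_
    simp only [NExpr.eval, RExpr.eval, State.tick_nat, State.tick_real, Nat.cast_zero,
      State.writeNat_nat_self, State.writeNat_real, State.writeReal_real, true_and]
    split_ifs with h1
    · rfl
    · exact hI i (by omega)
  intro s₁ hF₁ h₁
  have hL₁ := h.frame hF₁ (by decide)
  refine realizes_loop (n := N) (by exact hL₁.samples)
    (fun t (ω : Fin t → Fin k → Fin n) s' => ∀ i < K, s'.real 5 0 i = estimate I G T j ω i)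
    (fun ω i hi => by simp [estimate, h₁ i hi]) ?_
  intro t ht ω s₂ hF₂ h₂
  have hL₂ := (hL₁.frame hF₂ (by decide)).writeNat (a := 28) 0 0 t (by decide)
  refine (realizes_sample hL₂).seq_computes fun x s₃ hF₃ h₃ => ?_
  refine (computes_tryItems (j := j) (hL₂.frame hF₃ (by decide)) (T := T) ?_ ?_ h₃).mono ?_
  · rw [← hT]; funext t' l
    simp only [table]
    rw [hF₃.nat 2 (by decide)]
    simp [hF₂.nat 2 (by decide), hF₁.nat 2 (by decide)]
  · rw [hF₃.nat 31 (by decide)]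
    simp [hF₂.nat 31 (by decide), hF₁.nat 31 (by decide), h31]
  · intro s₄ hF₄ h₄ i hi
    rw [h₄ i hi, hF₃.real 5 (by decide)]
    simp [h₂ i hi, estimate, Fin.sum_univ_castSucc]

theorem computes_findBest (h : Loaded I n N s) :
    Computes O findBest s fun s' => s'.nat 8 0 0 = argmaxBelow (s.real 5 0) K := by
  refine Computes.seq (computes_setNat (Q := fun s' => Loaded I n N s' ∧ s'.nat 8 0 0 = 0)
    ⟨h.writeNat _ _ _ (by decide), by simp [NExpr.eval]⟩) ?_
  rintro s₁ hF₁ ⟨hL₁, h₁⟩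
  refine computes_loop (n := K) (by exact hL₁.items)
    (fun t s' => s'.nat 8 0 0 = argmaxBelow (s.real 5 0) t) (by simp [h₁, argmaxBelow]) ?_
  intro t ht s₂ hF₂ h₂
  have h5 : s₂.real 5 = s.real 5 := by rw [hF₂.real 5 (by decide), hF₁.real 5 (by decide)]
  refine computes_cond (fun hb => computes_setNat ?_) (fun hb => computes_skip ?_)
  · simp only [Test.Holds, RExpr.eval, NExpr.eval, State.tick_nat, State.tick_real,
      State.writeNat_real, State.writeNat_nat, h5] at hb
    simp [h₂] at hb
    simp [NExpr.eval, argmaxBelow, hb]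
  · simp only [Test.Holds, RExpr.eval, NExpr.eval, State.tick_nat, State.tick_real,
      State.writeNat_real, State.writeNat_nat, h5] at hb
    simp [h₂] at hb
    simp [argmaxBelow, hb.not_gt, h₂]

theorem equal_holds {e f : NExpr} : (equal e f).Holds s ↔ e.eval s = f.eval s := by
  simp only [Test.Holds]; omega

theorem realizes_fillEntry [NeZero n] {jstar t j : ℕ} (hK : 0 < K)
    (h : Loaded I n N s) (hT : table n k s = T) (h31 : s.nat 31 0 0 = j) (h30 : s.nat 30 0 0 = t)
    (h7 : s.nat 7 0 0 = jstar) :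
    Realizes (I.oracle G) (Ω := Fin N → Fin k → Fin n) fillEntry s
      fun ω s' => table n k s' = step I G jstar t j T ω := by
  refine (realizes_addSamples h hT h31).seq_computes fun ω s₁ hF₁ h₁ => ?_
  have hL₁ := h.frame hF₁ (by decide)
  refine Computes.seq (computes_findBest hL₁) fun s₂ hF₂ h₂ => ?_
  rw [argmaxBelow_congr hK h₁ le_rfl] at h₂
  have h2 : s₂.nat 2 = s.nat 2 := by rw [hF₂.nat 2 (by decide), hF₁.nat 2 (by decide)]
  have h31' : s₂.nat 31 0 0 = j := by rw [hF₂.nat 31 (by decide), hF₁.nat 31 (by decide), h31]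
  have h30' : s₂.nat 30 0 0 = t := by rw [hF₂.nat 30 (by decide), hF₁.nat 30 (by decide), h30]
  have h7' : s₂.nat 7 0 0 = jstar := by rw [hF₂.nat 7 (by decide), hF₁.nat 7 (by decide), h7]
  refine computes_cond (fun hb => computes_skip ?_) (fun hb => computes_setNat ?_)
  · simp only [equal_holds, NExpr.eval, h31', h7'] at hb
    rw [← hT]
    funext t' l
    simp [step, table, hb, h2]
  · simp only [equal_holds, NExpr.eval, h31', h7'] at hb
    rw [step, if_neg hb, ← hT]
    funext t' l
    simp [table, Table.set, NExpr.eval, State.writeNat_nat, h31', h30', h2, h₂, ← hT]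

theorem realizes_fillTable [NeZero n] [NeZero N] {jstar : ℕ} (hK : 0 < K)
    (h : Loaded I n N s) (hT : table n k s = T) (h7 : s.nat 7 0 0 = jstar) :
    Realizes (I.oracle G) (Ω := Fin n → Fin k → Fin N → Fin k → Fin n) fillTable s
      fun ω s' => table n k s' = fold (fun t => fold (step I G jstar t) k) n T ω := by
  refine realizes_loop (n := n) (by exact h.slots)
    (fun t (ω : Fin t → Fin k → Fin N → Fin k → Fin n) s' =>
      table n k s' = fold (fun t => fold (step I G jstar t) k) t T ω)
    (fun ω => by rw [fold]; exact hT) ?_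
  intro t ht ω s₁ hF₁ h₁
  simp only [fold_snoc]
  have hL₁ := (h.frame hF₁ (by decide)).writeNat (a := 30) 0 0 t (by decide)
  refine realizes_loop (n := k) (by exact hL₁.positions)
    (fun j (ω' : Fin j → Fin N → Fin k → Fin n) s' => table n k s' =
      fold (step I G jstar t) j (fold (fun t => fold (step I G jstar t) k) t T ω) ω')
    (fun ω' => by rw [fold, ← h₁]; funext t' l; simp [table]) ?_
  intro j hj ω' s₂ hF₂ h₂
  simp only [fold_snoc]
  have hL₂ := (hL₁.frame hF₂ (by decide)).writeNat (a := 31) 0 0 j (by decide)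
  refine realizes_fillEntry hK hL₂ (by rw [← h₂]; funext t' l; simp [table]) (by simp)
    ?_ ?_
  · simp [hF₂.nat 30 (by decide)]
  · simp [hF₂.nat 7 (by decide), hF₁.nat 7 (by decide), h7]

theorem computes_resetTable {p : Fin K × Fin k} (h : Loaded I n N s) (h6 : s.nat 6 0 0 = p.1)
    (h7 : s.nat 7 0 0 = p.2) :
    Computes O resetTable s fun s' => table n k s' = start K n k p := by
  refine (computes_loop (n := n) (by exact h.slots) (fun t s' =>
    ∀ (t' : Fin n) (l : Fin k), (t' : ℕ) < t → table n k s' t' l = start K n k p t' l) (by simp) ?_).mono ?_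
  · intro t ht s₁ hF₁ h₁
    have hL₁ := (h.frame hF₁ (by decide)).writeNat (a := 32) 0 0 t (by decide)
    refine (computes_loop (n := k) (by exact hL₁.positions) (fun j s' =>
      ∀ (t' : Fin n) (l : Fin k), (t' : ℕ) < t ∨ (t' : ℕ) = t ∧ (l : ℕ) < j →
        table n k s' t' l = start K n k p t' l) ?_ ?_).mono ?_
    · intro t' l hl
      simpa [table] using h₁ t' l (by omega)
    · intro j hj s₂ hF₂ h₂
      have e32 : s₂.nat 32 0 0 = t := by rw [hF₂.nat 32 (by decide)]; simp
      have e7 : s₂.nat 7 0 0 = p.2 := by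
        rw [hF₂.nat 7 (by decide)]; simp [hF₁.nat 7 (by decide), h7]
      have e6 : s₂.nat 6 0 0 = p.1 := by
        rw [hF₂.nat 6 (by decide)]; simp [hF₁.nat 6 (by decide), h6]
      have e0 := (hL₁.frame hF₂ (by decide)).items
      refine computes_cond (fun hb => computes_setNat fun t' l hl => ?_)
        (fun hb => computes_setNat fun t' l hl => ?_)
      · simp [equal_holds, NExpr.eval, e7] at hb
        by_cases hc : (t' : ℕ) = t ∧ (l : ℕ) = j
        · have : l = p.2 := Fin.ext (by omega)
          simp [table, NExpr.eval, State.writeNat_nat, e32, hc, e6, start, this, hb]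
        · simpa [table, NExpr.eval, State.writeNat_nat, e32, hc, e6] using h₂ t' l (by omega)
      · simp [equal_holds, NExpr.eval, e7] at hb
        by_cases hc : (t' : ℕ) = t ∧ (l : ℕ) = j
        · have : l ≠ p.2 := fun hlp => hb (by rw [← hlp]; omega)
          simp [table, NExpr.eval, State.writeNat_nat, e32, hc, e0, start, this]
        · simpa [table, NExpr.eval, State.writeNat_nat, e32, hc] using h₂ t' l (by omega)
    · intro s' _ h' t' l hl
      exact h' t' l (by omega)
  · intro s' _ h'
    funext t' l
    exact h' t' l t'.isLt

theorem realizes_guess [NeZero K] [NeZero k] (h : Loaded I n N s) :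
    Realizes O (Ω := Fin K × Fin k) guess s
      fun p s' => s'.nat 6 0 0 = p.1 ∧ s'.nat 7 0 0 = p.2 := by
  have hK := NeZero.pos K
  have hk := NeZero.pos k
  refine Realizes.seq (P := fun (i : Fin K) s' => s'.nat 6 0 0 = i)
    (realizes_random (by simp [NExpr.eval, h.items]; omega) fun v => by simp [NExpr.eval])
    fun i s₁ hF₁ h₁ => ?_
  have h0 := (h.frame hF₁ (by decide)).positions
  exact realizes_random (by simp [NExpr.eval, h0]; omega) fun v => by simp [NExpr.eval, h₁]

/-! ### Repairing assignments and keeping the best list -/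

/-- Replace the number in register `8` by the first unmarked item, if it is marked. -/
def search : Program :=
  .loop 35 .items (.cond (.natLT (.lit 0) (.entry 4 (.cell 8)))
    (.setNat 8 (.lit 0) (.lit 0) (.cell 35)) .skip)

/-- Replace repeated items in the assignment. -/
def repair : Program :=
  .seq unmark (.loop 34 .positions
    (.seq (.setNat 8 (.lit 0) (.lit 0) (.entry 3 (.cell 34)))
      (.seq search (.seq (.setNat 4 (.lit 0) (.cell 8) (.lit 1))
        (.setNat 3 (.lit 0) (.cell 34) (.cell 8))))))

/-- Keep the assignment if it is better than the best list so far. -/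
def record : Program :=
  .cond (.realLT (.get 6 (.lit 0) (.lit 0)) (.get 4 (.lit 0) (.lit 0)))
    (.seq (.setReal 6 (.lit 0) (.lit 0) (.get 4 (.lit 0) (.lit 0)))
      (.loop 36 .positions (.setNat 1 (.lit 0) (.cell 36) (.entry 3 (.cell 36)))))
    .skip

def finish : Program := .seq sample (.seq assign (.seq repair (.seq evaluate record)))

def trial : Program := .seq (.seq guess (.seq resetTable fillTable)) finish

/-- Repeat the trial, once for each sample. -/
def searchLists : Program :=
  .seq (.setReal 6 (.lit 0) (.lit 0) (.sub (.ofNat (.lit 0)) (.ofNat (.lit 1))))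
    (.loop 37 (.cell 11) trial)

/-- The random choices of one trial. -/
abbrev Choices (K k n N : ℕ) : Type :=
  ((Fin K × Fin k) × (Fin n → Fin k → Fin N → Fin k → Fin n)) × (Fin k → Fin n)

/-- The overlap of the assignment that a trial computes before its repair. -/
noncomputable def trialValue {K k m n N : ℕ} (I : Instance K k m)
    (G : (Fin m → ℝ) → (Fin m → ℝ) → ℝ) (ω : Choices K k n N) : ℝ :=
  I.partialValue G (pick (finalTable I G n ω.1.1 ω.1.2) ω.2)

variable {K k m n N : ℕ} {I : Instance K k m} {G : (Fin m → ℝ) → (Fin m → ℝ) → ℝ} {s : State}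
  {O : (ℕ → ℝ) → ℝ} {T : Table n k}

/-- A marked candidate is replaced by the loop counter. Hence at any time either the candidate is
free or all items tried so far are marked, and the existence of a free item excludes the latter at
the end. -/
theorem computes_search (h : Loaded I n N s) (hb : s.nat 8 0 0 < K)
    (hfree : ∃ x < K, s.nat 4 0 x = 0) :
    Computes O search s fun s' => s'.nat 8 0 0 < K ∧ s.nat 4 0 (s'.nat 8 0 0) = 0 ∧
      (s.nat 4 0 (s.nat 8 0 0) = 0 → s'.nat 8 0 0 = s.nat 8 0 0) := by
  refine (computes_loop (n := K) (by exact h.items) (fun t s' => s'.nat 8 0 0 < K ∧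
    (s.nat 4 0 (s'.nat 8 0 0) = 0 ∨ ∀ i < t, s.nat 4 0 i ≠ 0) ∧
      (s.nat 4 0 (s.nat 8 0 0) = 0 → s'.nat 8 0 0 = s.nat 8 0 0)) ?_ ?_).mono ?_
  · exact ⟨hb, Or.inr fun i hi => absurd hi (Nat.not_lt_zero i), fun _ => rfl⟩
  · rintro t ht s₁ hF ⟨h₁, h₂, h₃⟩
    have h4 : s₁.nat 4 = s.nat 4 := hF.nat 4 (by decide)
    refine computes_cond (fun hc => computes_setNat ?_) (fun hc => computes_skip ?_)
    · simp [Test.Holds, NExpr.eval, h4] at hc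
      simp only [NExpr.eval, State.tick_nat, State.writeNat_nat_self]
      refine ⟨ht, ?_, fun h0 => ?_⟩
      · by_cases h0 : s.nat 4 0 t = 0
        · exact Or.inl h0
        · refine Or.inr fun i hi => ?_
          rcases Nat.lt_succ_iff_lt_or_eq.1 hi with hi | rfl
          · exact (h₂.resolve_left hc.ne') i hi
          · exact h0
      · rw [h₃ h0] at hc
        omega
    · simp [Test.Holds, NExpr.eval, h4] at hc
      simpa [hc] using ⟨h₁, h₃⟩
  · rintro s' - ⟨h₁, h₂, h₃⟩
    obtain ⟨x, hx, hx0⟩ := hfree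
    exact ⟨h₁, h₂.resolve_right fun h => h x hx hx0, h₃⟩

/-- When an item's position is reached, the item is either still free and kept, or already placed at
an earlier position, possibly as a replacement there. In both cases it ends no later than it stood,
which is what decreasing weights require. -/
theorem computes_repair (h : Loaded I n N s) (hkK : k ≤ K) (ha : ∀ l, assignment k s l < K) :
    Computes O repair s fun s' => ∃ π : Fin k ↪ Fin K, (∀ l, assignment k s' l = π l) ∧
      ∀ l, ∃ l' ≤ l, (π l' : ℕ) = assignment k s l := by
  refine Computes.seq (computes_unmark h) fun s₁ hF₁ h₁ => ?_
  have hL₁ := h.frame hF₁ (by decide)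
  have e3 : s₁.nat 3 = s.nat 3 := hF₁.nat 3 (by decide)
  refine (computes_loop (n := k) (by exact hL₁.positions) (fun t s' =>
    (∀ l : Fin k, t ≤ l → s'.nat 3 0 l = assignment k s l) ∧
    (∀ l : Fin k, (l : ℕ) < t → s'.nat 3 0 l < K) ∧
    (∀ x < K, s'.nat 4 0 x = 0 ↔ ∀ l : Fin k, (l : ℕ) < t → s'.nat 3 0 l ≠ x) ∧
    (∀ l l' : Fin k, (l : ℕ) < t → (l' : ℕ) < t → s'.nat 3 0 l = s'.nat 3 0 l' → l = l') ∧
    ∀ l : Fin k, (l : ℕ) < t → ∃ l' ≤ l, s'.nat 3 0 l' = assignment k s l) ?_ ?_).mono ?_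
  · refine ⟨fun l _ => by simp [assignment, e3], by simp, fun x hx => by simp [h₁ x hx],
      by simp, by simp⟩
  · rintro t ht s₂ hF₂ ⟨hi, hii, hiii, hiv, hv⟩
    have hL₂ := (hL₁.frame hF₂ (by decide)).writeNat (a := 34) 0 0 t (by decide)
    -- Pigeonhole: fewer than `k ≤ K` items have been placed.
    have hfree : ∃ x < K, s₂.nat 4 0 x = 0 := by
      by_contra hne
      push Not at hne
      have : ∀ x : Fin K, ∃ l : Fin t, s₂.nat 3 0 l = x := by
        intro x
        have := (hiii x x.isLt).not.1 (hne x x.isLt)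
        push Not at this
        obtain ⟨l, hl, he⟩ := this
        exact ⟨⟨l, hl⟩, he⟩
      choose φ hφ using this
      have hinj : Function.Injective φ := fun x y hxy => Fin.ext (by rw [← hφ x, ← hφ y, hxy])
      have := Fintype.card_le_of_injective φ hinj
      simp only [Fintype.card_fin] at this
      omega
    refine Computes.seq (computes_setNat (Q := fun s' => Loaded I n N s' ∧
      s'.nat 8 0 0 = assignment k s ⟨t, ht⟩) ⟨hL₂.writeNat _ _ _ (by decide), ?_⟩) ?_
    · simpa [NExpr.eval] using hi ⟨t, ht⟩ le_rfl
    rintro s₃ hF₃ ⟨hL₃, h8⟩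
    have e3 : s₃.nat 3 = s₂.nat 3 := by
      rw [hF₃.nat 3 (by decide), State.tick_nat, State.writeNat_nat_of_ne _ _ _ _ (by decide)]
    have e4 : s₃.nat 4 = s₂.nat 4 := by
      rw [hF₃.nat 4 (by decide), State.tick_nat, State.writeNat_nat_of_ne _ _ _ _ (by decide)]
    have e34 : s₃.nat 34 0 0 = t := by rw [hF₃.nat 34 (by decide)]; simp
    refine Computes.seq (computes_search hL₃ (by rw [h8]; exact ha _) (by rwa [e4])) ?_
    rintro s₄ hF₄ ⟨hc, hc0, hcb⟩
    have e3' : s₄.nat 3 = s₂.nat 3 := by rw [hF₄.nat 3 (by decide), e3]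
    have e4' : s₄.nat 4 = s₂.nat 4 := by rw [hF₄.nat 4 (by decide), e4]
    have e34' : s₄.nat 34 0 0 = t := by rw [hF₄.nat 34 (by decide), e34]
    rw [e4] at hc0 hcb
    rw [h8] at hcb
    generalize hcc : s₄.nat 8 0 0 = c at hc hc0 hcb
    refine Computes.seq (computes_setNat (Q := fun s' => s'.nat 3 = s₂.nat 3 ∧
      s'.nat 8 0 0 = c ∧ s'.nat 34 0 0 = t ∧
      ∀ x, s'.nat 4 0 x = if x = c then 1 else s₂.nat 4 0 x) ?_) ?_
    · simp [NExpr.eval, hcc, e3', e4', e34', State.writeNat_nat]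
    rintro s₅ - ⟨e3, e8, e34, e4⟩
    refine computes_setNat ?_
    have new : ∀ l : ℕ, (s₅.writeNat 3 0 t c).tick.nat 3 0 l =
        if l = t then c else s₂.nat 3 0 l := by
      intro l; simp [State.writeNat_nat, e3]
    simp only [NExpr.eval, e34, e8, new]
    have hfresh := (hiii c hc).1 hc0
    refine ⟨fun l hl => ?_, fun l hl => ?_, fun x hx => ?_, fun l l' hl hl' => ?_, fun l hl => ?_⟩
    · rw [if_neg (by omega)]; exact hi l (by omega)
    · split_ifs
      · exact hc
      · exact hii l (by omega)
    · have : (s₅.writeNat 3 0 t c).tick.nat 4 0 x = if x = c then 1 else s₂.nat 4 0 x := by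
        simp [e4]
      rw [this]
      split_ifs with hxc
      · simp only [false_iff, not_forall]
        exact ⟨⟨t, ht⟩, Nat.lt_succ_self t, by simp [hxc]⟩
      · rw [hiii x hx]
        refine ⟨fun h l hl => ?_, fun h l hl => ?_⟩
        · split_ifs
          · exact Ne.symm hxc
          · exact h l (by omega)
        · have := h l (by omega)
          rwa [if_neg (by omega)] at this
    · split_ifs with h1 h2 h2
      · intro _; exact Fin.ext (h1.trans h2.symm)
      · intro he; exact absurd he.symm (hfresh l' (by omega))
      · intro he; exact absurd he (hfresh l (by omega))
      · exact hiv l l' (by omega) (by omega)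
    · by_cases hlt : (l : ℕ) < t
      · obtain ⟨l', hl', he⟩ := hv l hlt
        have := Fin.le_def.1 hl'
        exact ⟨l', hl', by rw [if_neg (by omega), he]⟩
      · obtain rfl : l = ⟨t, ht⟩ := Fin.ext (by simp only; omega)
        -- A free item is left where it is; a marked one has an earlier position by the meaning of
        -- the marks.
        by_cases hu : s₂.nat 4 0 (assignment k s ⟨t, ht⟩) = 0
        · exact ⟨⟨t, ht⟩, le_rfl, by simp [hcb hu]⟩
        · have := (hiii _ (ha ⟨t, ht⟩)).not.1 hu
          push Not at this
          obtain ⟨l', hl', he⟩ := this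
          exact ⟨l', Fin.le_def.2 hl'.le, by rw [if_neg (by omega), he]⟩
  · rintro s' - ⟨-, hii, -, hiv, hv⟩
    exact ⟨⟨fun l => ⟨s'.nat 3 0 l, hii l l.isLt⟩,
      fun l l' he => hiv l l' l.isLt l'.isLt (congrArg Fin.val he)⟩, fun l => rfl,
      fun l => hv l l.isLt⟩

theorem computes_record (h : Loaded I n N s) {π : Fin k ↪ Fin K}
    (hπ : ∀ l, assignment k s l = π l) (hv : s.real 4 0 0 = I.value G π) :
    Computes O record s fun s' => s.real 6 0 0 ≤ s'.real 6 0 0 ∧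
      I.value G π ≤ s'.real 6 0 0 ∧ ((s'.nat 1 = s.nat 1 ∧ s'.real 6 0 0 = s.real 6 0 0) ∨
        ((∀ l : Fin k, s'.nat 1 0 l = π l) ∧ s'.real 6 0 0 = I.value G π)) := by
  refine computes_cond (fun hb => ?_) (fun hb => computes_skip ?_)
  · simp [Test.Holds, RExpr.eval, NExpr.eval, hv] at hb
    refine Computes.seq (computes_setReal (Q := fun s' => Loaded I n N s' ∧ s'.nat 3 = s.nat 3 ∧
      s'.real 6 0 0 = I.value G π) ⟨h.tick.writeReal _ _ _ (by decide), ?_⟩) ?_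
    · simp [RExpr.eval, NExpr.eval, hv]
    rintro s₁ - ⟨hL₁, h3, h6⟩
    refine (computes_loop (n := k) (by exact hL₁.positions)
      (fun t s' => ∀ l : Fin k, (l : ℕ) < t → s'.nat 1 0 l = π l) (by simp) ?_).mono ?_
    · intro t ht s₂ hF₂ hI
      refine computes_setNat fun l hl => ?_
      have : s₂.nat 3 0 t = π ⟨t, ht⟩ := by
        rw [hF₂.nat 3 (by decide), h3]; exact hπ ⟨t, ht⟩
      by_cases h1 : (l : ℕ) = t
      · obtain rfl : l = ⟨t, ht⟩ := Fin.ext h1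
        simp [NExpr.eval, this]
      · simpa [NExpr.eval, State.writeNat_nat, h1] using hI l (by omega)
    · intro s₂ hF₂ h₂
      have h6' : s₂.real 6 0 0 = I.value G π := by rw [hF₂.real 6 (by decide), h6]
      rw [h6']
      exact ⟨hb.le, le_rfl, Or.inr ⟨fun l => h₂ l l.isLt, rfl⟩⟩
  · simp [Test.Holds, RExpr.eval, NExpr.eval, hv] at hb
    exact ⟨le_rfl, hb, Or.inl ⟨rfl, rfl⟩⟩

theorem partialMixture_list (I : Instance K k m) (π : Fin k ↪ Fin K) :
    I.partialMixture (fun l => (π l : ℕ)) = I.mixture π := by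
  funext g
  refine Finset.sum_congr rfl fun l _ => ?_
  rw [if_neg]
  · simp [Instance.item]
  · rintro ⟨l', hl', he⟩
    exact hl'.ne (π.injective (Fin.ext he))

theorem partialValue_list (I : Instance K k m) (G : (Fin m → ℝ) → (Fin m → ℝ) → ℝ)
    (π : Fin k ↪ Fin K) : I.partialValue G (fun l => (π l : ℕ)) = I.value G π := by
  rw [Instance.partialValue, partialMixture_list, Instance.value]

theorem item_nonneg (I : Instance K k m) (x : ℕ) (g : Fin m) : 0 ≤ I.item x g := by
  unfold Instance.item
  split_ifs
  · exact (I.genre_mem _).1 g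
  · exact le_rfl

theorem partialMixture_nonneg (I : Instance K k m) (a : Fin k → ℕ) (g : Fin m) :
    0 ≤ I.partialMixture a g :=
  Finset.sum_nonneg fun l _ => by
    split_ifs
    · exact le_rfl
    · exact mul_nonneg (I.weight_nonneg l) (item_nonneg I _ g)

/-- Only first occurrences of items contribute on the left. Sending each to a position of the same
item in the list is injective and never moves to a smaller weight; the remaining positions of the
list add nonnegative terms. -/
theorem partialMixture_le (I : Instance K k m) {a : Fin k → ℕ} {π : Fin k ↪ Fin K}
    (h : ∀ l, a l < K → ∃ l' ≤ l, (π l' : ℕ) = a l) (g : Fin m) :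
    I.partialMixture a g ≤ I.mixture π g := by
  classical
  choose! φ hφ using h
  let S : Finset (Fin k) := {l | a l < K ∧ ¬ ∃ l' < l, a l' = a l}
  have hS : ∀ l, l ∈ S ↔ a l < K ∧ ¬ ∃ l' < l, a l' = a l := fun l => by simp [S]
  have hinj : Set.InjOn φ S := by
    intro l hl l' hl' he
    rw [Finset.mem_coe, hS] at hl hl'
    have : a l = a l' := by rw [← (hφ l hl.1).2, ← (hφ l' hl'.1).2, he]
    rcases lt_trichotomy l l' with h | h | h
    · exact absurd ⟨l, h, this⟩ hl'.2
    · exact h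
    · exact absurd ⟨l', h, this.symm⟩ hl.2
  calc I.partialMixture a g = ∑ l ∈ S, I.weight l * I.item (a l) g := by
        rw [Instance.partialMixture, ← Finset.sum_subset (Finset.subset_univ S)]
        · exact Finset.sum_congr rfl fun l hl => if_neg ((hS l).1 hl).2
        · intro l _ hl
          rw [hS] at hl
          split_ifs with hd
          · rfl
          · have : ¬ a l < K := fun hK => hl ⟨hK, hd⟩
            simp [Instance.item, this]
    _ ≤ ∑ l ∈ S, I.weight (φ l) * I.genre (π (φ l)) g := by
        refine Finset.sum_le_sum fun l hl => ?_
        obtain ⟨h₁, h₂⟩ := hφ l ((hS l).1 hl).1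
        have : I.item (a l) g = I.genre (π (φ l)) g := by
          rw [← h₂]; simp [Instance.item]
        rw [this]
        exact mul_le_mul_of_nonneg_right (I.weight_antitone h₁) ((I.genre_mem _).1 g)
    _ = ∑ l ∈ S.image φ, I.weight l * I.genre (π l) g := by
        rw [Finset.sum_image hinj]
    _ ≤ I.mixture π g := Finset.sum_le_sum_of_subset_of_nonneg (Finset.subset_univ _)
        fun l _ _ => mul_nonneg (I.weight_nonneg l) ((I.genre_mem _).1 g)

theorem partialValue_le (hG : IsSMDR I G) {a : Fin k → ℕ} {π : Fin k ↪ Fin K}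
    (h : ∀ l, a l < K → ∃ l' ≤ l, (π l' : ℕ) = a l) : I.partialValue G a ≤ I.value G π :=
  hG.nondecreasing _ I.target_mem _ _ (partialMixture_nonneg I a) (partialMixture_le I h)

theorem realizes_finish [NeZero n] (hkK : k ≤ K) (hG : IsSMDR I G) (h : Loaded I n N s)
    (hT : table n k s = T) (hTK : ∀ t l, T t l < K) :
    Realizes (I.oracle G) (Ω := Fin k → Fin n) finish s fun x s' =>
      s.real 6 0 0 ≤ s'.real 6 0 0 ∧ I.partialValue G (pick T x) ≤ s'.real 6 0 0 ∧
      ((s'.nat 1 = s.nat 1 ∧ s'.real 6 0 0 = s.real 6 0 0) ∨ ∃ π : Fin k ↪ Fin K,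
        (∀ l : Fin k, s'.nat 1 0 l = π l) ∧ s'.real 6 0 0 = I.value G π) := by
  refine (realizes_sample h).seq_computes fun x s₁ hF₁ h₁ => ?_
  have hL₁ := h.frame hF₁ (by decide)
  refine Computes.seq (computes_assign hL₁ (T := T) ?_ h₁) fun s₂ hF₂ h₂ => ?_
  · rw [← hT]; funext t l
    simp only [table]
    rw [hF₁.nat 2 (by decide)]
  have hL₂ := hL₁.frame hF₂ (by decide)
  refine Computes.seq (computes_repair hL₂ hkK fun l => ?_) ?_
  · rw [h₂]; exact hTK _ _
  rintro s₃ hF₃ ⟨π, hπ, hr⟩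
  rw [h₂] at hr
  have hL₃ := hL₂.frame hF₃ (by decide)
  refine Computes.seq (computes_evaluate hL₃) fun s₄ hF₄ h₄ => ?_
  have hL₄ := hL₃.frame hF₄ (by decide)
  have hπ₄ : ∀ l, assignment k s₄ l = π l := by
    intro l
    rw [← hπ l, assignment, assignment, hF₄.nat 3 (by decide)]
  rw [show assignment k s₃ = fun l => (π l : ℕ) from funext hπ, partialValue_list] at h₄
  refine (computes_record hL₄ hπ₄ h₄).mono ?_
  have e6 : s₄.real 6 = s.real 6 := by
    rw [hF₄.real 6 (by decide), hF₃.real 6 (by decide), hF₂.real 6 (by decide),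
      hF₁.real 6 (by decide)]
  have e1 : s₄.nat 1 = s.nat 1 := by
    rw [hF₄.nat 1 (by decide), hF₃.nat 1 (by decide), hF₂.nat 1 (by decide),
      hF₁.nat 1 (by decide)]
  rw [e6, e1]
  rintro s₅ - ⟨h₅, h₆, h₇⟩
  exact ⟨h₅, (partialValue_le hG fun l _ => hr l).trans h₆, h₇.imp_right fun h => ⟨π, h⟩⟩

theorem fold_induction {β Ω : Type} {f : ℕ → β → Ω → β} (P : ℕ → β → Prop) {n : ℕ}
    (hstep : ∀ t < n, ∀ b x, P t b → P (t + 1) (f t b x)) {b : β} (h : P 0 b)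
    (ω : Fin n → Ω) : P n (fold f n b ω) := by
  induction n with
  | zero => exact h
  | succ n ih =>
    exact hstep n (Nat.lt_succ_self n) _ _ (ih (fun t ht => hstep t (by omega)) _)

/-- All slots of the position `jstar`, the slots before `t`, and slot `t` of the positions before
`j` are filled. -/
def Table.Filled (K : ℕ) (jstar t j : ℕ) (T : Table n k) : Prop :=
  ∀ (t' : Fin n) (l : Fin k), ((l : ℕ) = jstar ∨ (t' : ℕ) < t ∨ (t' : ℕ) = t ∧ (l : ℕ) < j) →
    T t' l < K

theorem Table.Filled.step {jstar t j : ℕ} (hK : 0 < K) (h : T.Filled K jstar t j)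
    (ω : Fin N → Fin k → Fin n) : (step I G jstar t j T ω).Filled K jstar t (j + 1) := by
  intro t' l hl
  unfold Algorithm.step
  split_ifs with hj
  · exact h t' l (by omega)
  · unfold Table.set
    split_ifs with hc
    · exact argmaxBelow_lt _ hK
    · exact h t' l (by omega)

/-- Repair expects an item at every position. After all rounds no slot is empty, whichever samples
were drawn. -/
theorem finalTable_lt (hK : 0 < K) (p : Fin K × Fin k)
    (ω : Fin n → Fin k → Fin N → Fin k → Fin n) (t : Fin n) (l : Fin k) :
    finalTable I G n p ω t l < K := by
  have := fold_induction (f := fun t => fold (step I G p.2 t) k)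
    (fun t T => T.Filled K p.2 t 0) (n := n) (b := start K n k p) ?_ ?_ ω
  · exact this t l (Or.inr (Or.inl t.isLt))
  · intro t _ T x hT
    have := fold_induction (f := Algorithm.step I G p.2 t) (fun j T => T.Filled K p.2 t j)
      (fun j _ T x hT => hT.step hK x) hT x
    intro t' l hl
    exact this t' l (by omega)
  · intro t' l hl
    have : l = p.2 := Fin.ext (by omega)
    simp [start, this]

theorem realizes_trial [NeZero K] [NeZero k] [NeZero n] [NeZero N] (hkK : k ≤ K)
    (hG : IsSMDR I G) (h : Loaded I n N s) :
    Realizes (I.oracle G) (Ω := Choices K k n N) trial s fun ω s' =>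
      s.real 6 0 0 ≤ s'.real 6 0 0 ∧ trialValue I G ω ≤ s'.real 6 0 0 ∧
      ((s'.nat 1 = s.nat 1 ∧ s'.real 6 0 0 = s.real 6 0 0) ∨ ∃ π : Fin k ↪ Fin K,
        (∀ l : Fin k, s'.nat 1 0 l = π l) ∧ s'.real 6 0 0 = I.value G π) := by
  have hK := NeZero.pos K
  refine Realizes.seq (P := fun ω s' => table n k s' = finalTable I G n ω.1 ω.2) ?_ ?_
  · refine Realizes.seq (realizes_guess h) ?_
    rintro p s₁ hF₁ ⟨h6, h7⟩
    have hL₁ := h.frame hF₁ (by decide)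
    refine Computes.seq_realizes (computes_resetTable hL₁ h6 h7) fun s₂ hF₂ h₂ => ?_
    exact realizes_fillTable hK (hL₁.frame hF₂ (by decide)) h₂
      (by rw [hF₂.nat 7 (by decide), h7])
  · intro ω s₁ hF₁ h₁
    refine (realizes_finish hkK hG (h.frame hF₁ (by decide)) h₁ (finalTable_lt hK _ _)).mono ?_
    rw [hF₁.real 6 (by decide), hF₁.nat 1 (by decide)]
    exact fun _ _ _ h => h

/-- The best list so far is in row `0` of the integer array `1`, unless there is none. -/
theorem realizes_searchLists [NeZero K] [NeZero k] [NeZero n] [NeZero N] (hkK : k ≤ K)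
    (hG : IsSMDR I G) (h : Loaded I n N s) (hnonneg : ∀ ω : Choices K k n N, 0 ≤ trialValue I G ω) :
    Realizes (I.oracle G) (Ω := Fin N → Choices K k n N) searchLists s fun ω s' =>
      ∃ π : Fin k ↪ Fin K, (∀ l : Fin k, s'.nat 1 0 l = π l) ∧
        ∀ r, trialValue I G (ω r) ≤ I.value G π := by
  refine Computes.seq_realizes (computes_setReal (Q := fun s' => Loaded I n N s' ∧
    s'.real 6 0 0 = -1) ⟨h.writeReal _ _ _ (by decide), by simp [NExpr.eval, RExpr.eval]⟩) ?_
  rintro s₁ - ⟨hL₁, h₁⟩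
  refine (realizes_loop (n := N) (by exact hL₁.samples)
    (fun t (ω : Fin t → Choices K k n N) s' => (s'.real 6 0 0 = -1 ∨ ∃ π : Fin k ↪ Fin K,
      (∀ l : Fin k, s'.nat 1 0 l = π l) ∧ s'.real 6 0 0 = I.value G π) ∧
      ∀ r, trialValue I G (ω r) ≤ s'.real 6 0 0) ?_ ?_).mono ?_
  · exact fun ω => ⟨Or.inl h₁, fun r => r.elim0⟩
  · rintro t ht ω s₂ hF₂ ⟨h₂, h₃⟩
    have hL₂ := (hL₁.frame hF₂ (by decide)).writeNat (a := 37) 0 0 t (by decide)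
    refine (realizes_trial hkK hG hL₂).mono ?_
    rintro x s₃ - ⟨hle, hx, hor⟩
    simp only [State.tick_real, State.writeNat_real, State.tick_nat, ne_eq,
      not_false_eq_true, State.writeNat_nat_of_ne, OfNat.one_ne_ofNat] at hle hor
    constructor
    · rcases hor with ⟨e1, e6⟩ | hor
      · rwa [e1, e6]
      · exact Or.inr hor
    · intro r
      refine Fin.lastCases ?_ (fun r => ?_) r
      · simpa using hx
      · simpa using (h₃ r).trans hle
  · rintro ω s' - ⟨hor, hle⟩
    -- There is at least one trial and its value is nonnegative, so the record cannot still be the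
    -- initial `-1`, and a list has been stored.
    have hr := hle ⟨0, NeZero.pos N⟩
    rcases hor with h6 | ⟨π, hπ, h6⟩
    · have := hnonneg (ω ⟨0, NeZero.pos N⟩)
      rw [h6] at hr
      linarith
    · exact ⟨π, hπ, fun r => h6 ▸ hle r⟩

end Algorithm

open scoped BigOperators
open Algorithm

/-! ### Finite averages and the error of sampling -/

section Expectation

variable {α β Ω : Type} [Fintype α] [Fintype β] [Fintype Ω]

theorem expect_prod (φ : α × β → ℝ) : 𝔼 x, φ x = 𝔼 a, 𝔼 b, φ (a, b) := by
  rw [← Finset.univ_product_univ, Finset.expect_product]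

theorem expect_snoc {t : ℕ} (φ : (Fin (t + 1) → Ω) → ℝ) :
    𝔼 ω, φ ω = 𝔼 ω : Fin t → Ω, 𝔼 x, φ (Fin.snoc (α := fun _ => Ω) ω x) := by
  rw [← Fintype.expect_equiv (Fin.snocEquiv fun _ => Ω)
    (fun y => φ (Fin.snoc (α := fun _ => Ω) y.2 y.1)) φ (fun _ => rfl), expect_prod,
    Finset.expect_comm]

/-- Exchanging the coordinate `x j` with an independent `u` is an involution of the product space.
-/
theorem expect_update {ι : Type} [Fintype ι] [DecidableEq ι] [Nonempty α] (j : ι)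
    (φ : (ι → α) → ℝ) : 𝔼 x, φ x = 𝔼 x, 𝔼 u, φ (Function.update x j u) := by
  have h := Fintype.expect_equiv (M := ℝ)
    (⟨fun y => (Function.update y.1 j y.2, y.1 j), fun y => (Function.update y.1 j y.2, y.1 j),
      fun y => by simp, fun y => by simp⟩ : (ι → α) × α ≃ (ι → α) × α)
    (fun y => φ (Function.update y.1 j y.2)) (fun y => φ y.1) (fun _ => rfl)
  rw [expect_prod, expect_prod] at h
  rw [h]
  simp

/-- If each update loses at most `δ` in conditional expectation, the losses add up. The predicate
`P` holds for every outcome of the draws, which allows the one-step bound to be used under it. -/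
theorem le_expect_fold [Nonempty Ω] {B : Type} {f : ℕ → B → Ω → B} {n : ℕ} (P : ℕ → B → Prop)
    (V : ℕ → B → ℝ) (δ : ℝ) (hP : ∀ t < n, ∀ b x, P t b → P (t + 1) (f t b x))
    (hV : ∀ t < n, ∀ b, P t b → V t b - δ ≤ 𝔼 x, V (t + 1) (f t b x)) {b : B} (h : P 0 b) :
    V 0 b - n * δ ≤ 𝔼 ω, V n (fold f n b ω) := by
  induction n with
  | zero => simp [fold]
  | succ n ih =>
    have ih := ih (fun t ht => hP t (by omega)) (fun t ht => hV t (by omega))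
    rw [expect_snoc]
    simp only [fold_snoc]
    calc V 0 b - (n + 1 : ℕ) * δ = (V 0 b - n * δ) - δ := by push_cast; ring
      _ ≤ (𝔼 ω, V n (fold f n b ω)) - δ := by linarith
      _ = 𝔼 ω : Fin n → Ω, (V n (fold f n b ω) - δ) := by
          rw [Finset.expect_sub_distrib, Fintype.expect_const]
      _ ≤ _ := Finset.expect_le_expect fun ω _ =>
          hV n (by omega) _ (fold_induction P (fun t ht => hP t (by omega)) h ω)

theorem expect_sum_eq_zero {Y : α → ℝ} (hY : 𝔼 a, Y a = 0) (N : ℕ) :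
    𝔼 ω : Fin N → α, ∑ r, Y (ω r) = 0 := by
  induction N with
  | zero => simp
  | succ N ih =>
    cases isEmpty_or_nonempty α
    · simp [Finset.expect]
    · rw [expect_snoc]
      simp [Fin.sum_univ_castSucc, Finset.expect_add_distrib, ih, hY]

/-- The samples are independent and centred, so the cross terms vanish and only the individual
second moments remain. -/
theorem expect_sum_sq_le [Nonempty α] {Y : α → ℝ} {M : ℝ} (hY : 𝔼 a, Y a = 0)
    (hM : ∀ a, |Y a| ≤ M) (N : ℕ) : 𝔼 ω : Fin N → α, (∑ r, Y (ω r)) ^ 2 ≤ N * M ^ 2 := by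
  induction N with
  | zero => simp
  | succ N ih =>
    rw [expect_snoc]
    have h : ∀ ω : Fin N → α, 𝔼 x, (∑ r, Y (Fin.snoc (α := fun _ => α) ω x r)) ^ 2 ≤
        (∑ r, Y (ω r)) ^ 2 + M ^ 2 := by
      intro ω
      have : ∀ x, (∑ r, Y (Fin.snoc (α := fun _ => α) ω x r)) ^ 2 =
          (∑ r, Y (ω r)) ^ 2 + 2 * (∑ r, Y (ω r)) * Y x + Y x ^ 2 := by
        intro x
        simp only [Fin.sum_univ_castSucc, Fin.snoc_castSucc, Fin.snoc_last]
        ring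
      simp only [this, Finset.expect_add_distrib, ← Finset.mul_expect, hY, mul_zero, add_zero,
        Fintype.expect_const]
      have : 𝔼 x, Y x ^ 2 ≤ M ^ 2 := Finset.expect_le Finset.univ_nonempty
        fun x _ => sq_le_sq.2 ((hM x).trans (le_abs_self M))
      linarith
    calc _ ≤ 𝔼 ω : Fin N → α, ((∑ r, Y (ω r)) ^ 2 + M ^ 2) :=
          Finset.expect_le_expect fun ω _ => h ω
      _ = (𝔼 ω : Fin N → α, (∑ r, Y (ω r)) ^ 2) + M ^ 2 := by
          rw [Finset.expect_add_distrib, Fintype.expect_const]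
      _ ≤ _ := by push_cast; linarith

/-- Cauchy–Schwarz applied to the second moment. A square number of samples makes the root an
integer multiple of `M`. -/
theorem expect_abs_sum_le [Nonempty α] {Y : α → ℝ} {M : ℝ} (hY : 𝔼 a, Y a = 0)
    (hM : ∀ a, |Y a| ≤ M) (q : ℕ) :
    𝔼 ω : Fin (q ^ 2) → α, |∑ r, Y (ω r)| ≤ q * M := by
  have hM0 : 0 ≤ M := (abs_nonneg _).trans (hM (Classical.arbitrary α))
  refine le_of_sq_le_sq ?_ (by positivity)
  have h := Finset.expect_mul_sq_le_sq_mul_sq Finset.univ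
    (fun ω : Fin (q ^ 2) → α => |∑ r, Y (ω r)|) (fun _ => 1)
  simp only [mul_one, one_pow, Fintype.expect_const, sq_abs] at h
  calc _ ≤ _ := h
    _ ≤ _ := expect_sum_sq_le hY hM _
    _ = _ := by push_cast; ring

/-- The item that is best on average over the samples is almost best. -/
theorem le_expect_argmaxBelow [Nonempty α] {X : ℕ → α → ℝ} {M : ℝ} (hX : ∀ i a, 0 ≤ X i a)
    (hM : ∀ i a, X i a ≤ M) {K q o : ℕ} (hq : 0 < q) (ho : o < K) :
    (𝔼 a, X o a) - K * M / q ≤ 𝔼 ω : Fin (q ^ 2) → α,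
      𝔼 a, X (argmaxBelow (fun i => ∑ r, X i (ω r)) K) a := by
  set μ : ℕ → ℝ := fun i => 𝔼 a, X i a with hμ
  set c : (Fin (q ^ 2) → α) → ℕ := fun ω => argmaxBelow (fun i => ∑ r, X i (ω r)) K with hc
  set e : ℕ → (Fin (q ^ 2) → α) → ℝ := fun i ω => ∑ r, (X i (ω r) - μ i) with he
  have hμ0 : ∀ i, 0 ≤ μ i := fun i => Finset.expect_nonneg fun a _ => hX i a
  have hμM : ∀ i, μ i ≤ M := fun i => Finset.expect_le Finset.univ_nonempty fun a _ => hM i a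
  have hY : ∀ i, 𝔼 a, (X i a - μ i) = 0 := fun i => by
    rw [Finset.expect_sub_distrib, Fintype.expect_const, sub_self]
  have hYM : ∀ i a, |X i a - μ i| ≤ M := fun i a => by
    rw [abs_le]; constructor <;> linarith [hX i a, hM i a, hμ0 i, hμM i]
  have hes : ∀ i ω, e i ω = (∑ r, X i (ω r)) - (q : ℝ) ^ 2 * μ i := fun i ω => by
    simp [he, Finset.sum_sub_distrib]
  have hck : ∀ ω, c ω < K := fun ω => argmaxBelow_lt _ (by omega)
  -- The chosen item depends on the samples, so its deviation is bounded by the sum over all items.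
  -- The item `o` is fixed, and its deviation vanishes on average.
  have key : ∀ ω, (q : ℝ) ^ 2 * (μ o - μ (c ω)) ≤ -e o ω + ∑ i ∈ Finset.range K, |e i ω| := by
    intro ω
    have h₁ : ∑ r, X o (ω r) ≤ ∑ r, X (c ω) (ω r) :=
      le_argmaxBelow (fun i => ∑ r, X i (ω r)) ho
    have h₂ : |e (c ω) ω| ≤ ∑ i ∈ Finset.range K, |e i ω| :=
      Finset.single_le_sum (f := fun i => |e i ω|) (fun i _ => abs_nonneg _)
        (Finset.mem_range.2 (hck ω))
    have h₃ := le_abs_self (e (c ω) ω)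
    have h₄ := hes o ω
    have h₅ := hes (c ω) ω
    linarith
  have hsum : 𝔼 ω, ((q : ℝ) ^ 2 * (μ o - μ (c ω))) ≤ K * (q * M) := by
    calc _ ≤ 𝔼 ω, (-e o ω + ∑ i ∈ Finset.range K, |e i ω|) :=
          Finset.expect_le_expect fun ω _ => key ω
      _ = ∑ i ∈ Finset.range K, 𝔼 ω, |e i ω| := by
          have h0 : 𝔼 ω, e o ω = 0 := expect_sum_eq_zero (hY o) _
          rw [Finset.expect_add_distrib, Finset.expect_neg_distrib, h0, Finset.expect_sum_comm,
            neg_zero, zero_add]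
      _ ≤ ∑ i ∈ Finset.range K, q * M :=
          Finset.sum_le_sum fun i _ => expect_abs_sum_le (hY i) (hYM i) q
      _ = _ := by simp
  rw [← Finset.mul_expect, Finset.expect_sub_distrib, Fintype.expect_const] at hsum
  have hq' : (0 : ℝ) < q := by exact_mod_cast hq
  have : μ o - (𝔼 ω, μ (c ω)) ≤ K * M / q := by
    rw [le_div_iff₀ hq']
    nlinarith
  linarith

end Expectation

/-! ### Diminishing returns of submodular functions -/

section Submodular

variable {E : Type} [DecidableEq E] {f : Finset E → ℝ}

/-- Submodularity for `A ∪ C` and `B`: their intersection contains `A`, and their union contains `B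
∪ C`, so monotonicity finishes. -/
theorem diminishing (hmono : Monotone f) (hsub : ∀ R T, f (R ∪ T) + f (R ∩ T) ≤ f R + f T)
    {A B : Finset E} (hAB : A ⊆ B) (C : Finset E) : f (B ∪ C) - f B ≤ f (A ∪ C) - f A := by
  have h := hsub (A ∪ C) B
  have h₁ : f A ≤ f ((A ∪ C) ∩ B) :=
    hmono (Finset.subset_inter Finset.subset_union_left hAB)
  have h₂ : f (B ∪ C) ≤ f ((A ∪ C) ∪ B) := hmono (by
    intro x hx
    simp only [Finset.mem_union] at hx ⊢
    tauto)
  linarith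

/-- Each added element costs `f ∅ ≥ 0` at most. Since `f ∅` need not vanish, the empty set is
excluded. -/
theorem le_sum_singletons (hmono : Monotone f)
    (hsub : ∀ R T, f (R ∪ T) + f (R ∩ T) ≤ f R + f T) (h0 : 0 ≤ f ∅) {S : Finset E}
    (hS : S.Nonempty) : f S ≤ ∑ e ∈ S, f {e} := by
  induction hS using Finset.Nonempty.cons_induction with
  | singleton a => simp
  | cons a s ha hs ih =>
    rw [Finset.sum_cons, Finset.cons_eq_insert, Finset.insert_eq]
    have h := hsub {a} s
    have : f ∅ ≤ f ({a} ∩ s) := hmono (Finset.empty_subset _)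
    linarith

end Submodular

/-! ### Assignments as sets of item-position pairs -/

section Slots

variable {K k m n : ℕ}

/-- The item-position pairs of an assignment of items to positions. -/
def pairs (K : ℕ) (a : Fin k → ℕ) : Finset (Fin K × Fin k) := {e | a e.2 = e.1}

theorem mem_pairs {a : Fin k → ℕ} {e : Fin K × Fin k} : e ∈ pairs K a ↔ a e.2 = e.1 := by
  simp [pairs]

/-- At position `j` the assignment contributes a new item to `F_G` exactly if its item there is
genuine and has not occurred before. -/
theorem partialValue_eq_setValue (I : Instance K k m) (G : (Fin m → ℝ) → (Fin m → ℝ) → ℝ)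
    (a : Fin k → ℕ) : I.partialValue G a = I.setValue G (pairs K a) := by
  unfold Instance.partialValue Instance.setValue
  congr 1
  funext g
  refine Finset.sum_congr rfl fun j _ => ?_
  have hmem : ∀ i : Fin K, i ∈ itemsUpTo (pairs K a) j \ itemsBefore (pairs K a) j ↔
      a j = i ∧ ¬ ∃ l < j, a l = i := by
    intro i
    simp only [itemsUpTo, itemsBefore, Finset.mem_sdiff, Finset.mem_filter, Finset.mem_univ,
      true_and, mem_pairs]
    constructor
    · rintro ⟨⟨l, hl, h₁⟩, h₂⟩
      rcases hl.lt_or_eq with h | rfl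
      · exact absurd ⟨l, h, h₁⟩ h₂
      · exact ⟨h₁, h₂⟩
    · rintro ⟨h₁, h₂⟩
      exact ⟨⟨j, le_rfl, h₁⟩, h₂⟩
  by_cases hd : ∃ l < j, a l = a j
  · rw [if_pos hd, Finset.sum_eq_zero, mul_zero]
    intro i hi
    rw [hmem] at hi
    exact absurd (hi.1 ▸ hd) hi.2
  · rw [if_neg hd]
    congr 1
    by_cases hK : a j < K
    · have : itemsUpTo (pairs K a) j \ itemsBefore (pairs K a) j = {⟨a j, hK⟩} := by
        ext i
        rw [hmem, Finset.mem_singleton, Fin.ext_iff]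
        constructor
        · rintro ⟨h, -⟩; exact h.symm
        · rintro h
          simp only at h
          rw [h]
          exact ⟨rfl, hd⟩
      rw [this, Finset.sum_singleton, Instance.item, dif_pos hK]
    · rw [Finset.sum_eq_zero, Instance.item, dif_neg hK]
      intro i hi
      rw [hmem] at hi
      exact absurd (hi.1 ▸ i.isLt) hK

/-- First occurrences carry distinct items, so they define a partial injection, which extends to all
positions because `k ≤ K`. The witness for an item is its first position. -/
theorem exists_list (hkK : k ≤ K) (a : Fin k → ℕ) :
    ∃ π : Fin k ↪ Fin K, ∀ l, a l < K → ∃ l' ≤ l, (π l' : ℕ) = a l := by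
  classical
  rcases Nat.eq_zero_or_pos k with rfl | hk
  · exact ⟨⟨fun l => l.elim0, fun l => l.elim0⟩, fun l => l.elim0⟩
  let b : Fin k → Fin K := fun l => if h : a l < K then ⟨a l, h⟩ else ⟨0, by omega⟩
  let D : Finset (Fin k) := {l | a l < K ∧ ∀ l' < l, a l' ≠ a l}
  have hD : ∀ l, l ∈ D ↔ a l < K ∧ ∀ l' < l, a l' ≠ a l := fun l => by simp [D]
  have hb : ∀ l, a l < K → (b l : ℕ) = a l := fun l hl => by simp [b, hl]
  have hinj : Set.InjOn b D := by
    intro l hl l' hl' he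
    rw [Finset.mem_coe, hD] at hl hl'
    have : a l = a l' := by rw [← hb l hl.1, ← hb l' hl'.1, he]
    rcases lt_trichotomy l l' with h | h | h
    · exact absurd this (hl'.2 l h)
    · exact h
    · exact absurd this.symm (hl.2 l' h)
  obtain ⟨t, hDt, -, ht⟩ := Finset.exists_subsuperset_card_eq (n := k)
    (Finset.subset_univ (D.image b))
    (Finset.card_image_le.trans ((Finset.card_le_univ D).trans (by simp))) (by simpa using hkK)
  obtain ⟨g, hg⟩ := Set.MapsTo.exists_equiv_extend_of_card_eq (t := t) (by simpa using ht.symm)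
    (s := (D : Set (Fin k))) (f := b)
    (fun l hl => hDt (Finset.mem_image_of_mem b hl)) hinj
  refine ⟨⟨fun l => g l, fun l l' h => g.injective (Subtype.ext h)⟩, fun l hl => ?_⟩
  let S : Finset (Fin k) := {l' | a l' = a l}
  have hS : S.Nonempty := ⟨l, by simp [S]⟩
  have hmin : a (S.min' hS) = a l := by simpa [S] using S.min'_mem hS
  refine ⟨S.min' hS, S.min'_le l (by simp [S]), ?_⟩
  have : S.min' hS ∈ D := by
    rw [hD, hmin]
    refine ⟨hl, fun l' hl' he => ?_⟩
    exact hl'.not_ge (S.min'_le l' (by simp [S, he]))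
  change ((g (S.min' hS) : Fin K) : ℕ) = a l
  rw [hg _ this, hb _ (by rw [hmin]; exact hl), hmin]

end Slots

/-! ### Effect of filling one slot -/

section Greedy

variable {K k n : ℕ}

/-- The pairs of the first `j` positions of the assignment `o`. -/
def prefixPairs (o : Fin k → Fin K) (j : ℕ) : Finset (Fin K × Fin k) :=
  {e | o e.2 = e.1 ∧ (e.2 : ℕ) < j}

theorem prefixPairs_succ (o : Fin k → Fin K) {j : ℕ} (hj : j < k) :
    prefixPairs o (j + 1) = prefixPairs o j ∪ {(o ⟨j, hj⟩, ⟨j, hj⟩)} := by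
  ext ⟨i, l⟩
  simp only [prefixPairs, Finset.mem_filter, Finset.mem_univ, true_and, Finset.mem_union,
    Finset.mem_singleton, Prod.mk.injEq]
  constructor
  · rintro ⟨h₁, h₂⟩
    rcases Nat.lt_succ_iff_lt_or_eq.1 h₂ with h | h
    · exact Or.inl ⟨h₁, h⟩
    · obtain rfl : l = ⟨j, hj⟩ := Fin.ext h
      exact Or.inr ⟨h₁.symm, rfl⟩
  · rintro (⟨h₁, h₂⟩ | ⟨rfl, rfl⟩)
    · exact ⟨h₁, by omega⟩
    · exact ⟨rfl, Nat.lt_succ_self j⟩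

theorem prefixPairs_full (o : Fin k → Fin K) : prefixPairs o k = pairs K fun l => (o l : ℕ) := by
  ext ⟨i, l⟩
  simp [prefixPairs, mem_pairs, Fin.ext_iff]

variable (f : Finset (Fin K × Fin k) → ℝ)

/-- The expected value of a uniformly random choice of slots. -/
noncomputable def average (T : Table n k) : ℝ := 𝔼 x : Fin k → Fin n, f (pairs K (pick T x))

/-- The expected value with item `i` at position `j`. -/
noncomputable def averageWith (T : Table n k) (j i : ℕ) : ℝ :=
  𝔼 x : Fin k → Fin n, f (pairs K (pickWith T x j i))

/-- The expected increase when `C` is added. -/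
noncomputable def increase (T : Table n k) (C : Finset (Fin K × Fin k)) : ℝ :=
  𝔼 x : Fin k → Fin n, (f (pairs K (pick T x) ∪ C) - f (pairs K (pick T x)))

variable {f} {T : Table n k}

/-- The new entry matters only if slot `t` is drawn at position `j`, an event of probability `1/n`;
then the former empty entry, the number `K`, is replaced by `i`. Resampling coordinate `j` isolates
this event. -/
theorem average_set [NeZero n] {t : Fin n} {j : Fin k} (hT : T t j = K) (i : ℕ) :
    average f (T.set t j i) - average f T =
      1 / n * (averageWith f T j i - averageWith f T j K) := by
  have hu : ∀ (x : Fin k → Fin n) (u : Fin n), u ≠ t →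
      pick (T.set t j i) (Function.update x j u) = pick T (Function.update x j u) := by
    intro x u hut
    funext l
    unfold pick Table.set
    rw [if_neg]
    rintro ⟨h₁, h₂⟩
    obtain rfl : l = j := Fin.ext h₂
    rw [Function.update_self] at h₁
    exact hut (Fin.ext h₁)
  have ht : ∀ x : Fin k → Fin n,
      pick (T.set t j i) (Function.update x j t) = pickWith T x j i := by
    intro x
    funext l
    by_cases h : l = j
    · subst h; simp [pick, Table.set, pickWith]
    · have h' : (l : ℕ) ≠ j := fun h' => h (Fin.ext h')
      simp [pick, Table.set, pickWith, h, h']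
  have ht' : ∀ x : Fin k → Fin n, pick T (Function.update x j t) = pickWith T x j K := by
    intro x
    funext l
    by_cases h : l = j
    · subst h; simp [pick, pickWith, hT]
    · have h' : (l : ℕ) ≠ j := fun h' => h (Fin.ext h')
      simp [pick, pickWith, h, h']
  unfold average averageWith
  rw [← Finset.expect_sub_distrib, ← Finset.expect_sub_distrib, expect_update j,
    Finset.mul_expect]
  refine Finset.expect_congr rfl fun x _ => ?_
  rw [Fintype.expect_eq_sum_div_card, Finset.sum_eq_single t]
  · rw [ht, ht', Fintype.card_fin]; ring
  · intro u _ hut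
    rw [hu x u hut, sub_self]
  · simp

theorem pairs_pick_subset_set {t : Fin n} {j : Fin k} (hT : T t j = K) (i : ℕ)
    (x : Fin k → Fin n) : pairs K (pick T x) ⊆ pairs K (pick (T.set t j i) x) := by
  intro e he
  rw [mem_pairs] at he ⊢
  rw [← he]
  unfold pick Table.set at *
  rw [if_neg]
  rintro ⟨h₁, h₂⟩
  rw [Fin.ext h₁, Fin.ext h₂, hT] at he
  exact absurd he e.1.isLt.ne'

/-- Filling an empty slot only adds pairs to every random assignment, so returns diminish. -/
theorem increase_anti_set (hmono : Monotone f)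
    (hsub : ∀ R T, f (R ∪ T) + f (R ∩ T) ≤ f R + f T) {t : Fin n} {j : Fin k} (hT : T t j = K)
    (i : ℕ) (C : Finset (Fin K × Fin k)) : increase f (T.set t j i) C ≤ increase f T C :=
  Finset.expect_le_expect fun x _ => diminishing hmono hsub (pairs_pick_subset_set hT i x) C

theorem increase_union_le (hmono : Monotone f)
    (hsub : ∀ R T, f (R ∪ T) + f (R ∩ T) ≤ f R + f T) (C D : Finset (Fin K × Fin k)) :
    increase f T (C ∪ D) ≤ increase f T C + increase f T D := by
  unfold increase
  rw [← Finset.expect_add_distrib]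
  refine Finset.expect_le_expect fun x _ => ?_
  have := diminishing hmono hsub
    (Finset.subset_union_left : pairs K (pick T x) ⊆ pairs K (pick T x) ∪ C) D
  rw [Finset.union_assoc] at this
  linarith

/-- Emptying position `j` first can only raise the gain from adding `(i, j)`, and afterwards adding
the pair amounts to putting `i` at `j`. This is the quantity that the estimates compare. -/
theorem increase_singleton_le (hmono : Monotone f)
    (hsub : ∀ R T, f (R ∪ T) + f (R ∩ T) ≤ f R + f T) (i : Fin K) (j : Fin k) :
    increase f T {(i, j)} ≤ averageWith f T j i - averageWith f T j K := by
  unfold increase averageWith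
  rw [← Finset.expect_sub_distrib]
  refine Finset.expect_le_expect fun x _ => ?_
  have h₁ : pairs K (pickWith T x j K) ⊆ pairs K (pick T x) := by
    intro e he
    rw [mem_pairs] at he ⊢
    unfold pickWith at he
    split_ifs at he with h
    · exact absurd he e.1.isLt.ne'
    · exact he
  have h₂ : pairs K (pickWith T x j i) = pairs K (pickWith T x j K) ∪ {(i, j)} := by
    ext ⟨i', l⟩
    rw [Finset.mem_union, mem_pairs, mem_pairs, Finset.mem_singleton, Prod.mk.injEq]
    unfold pickWith
    by_cases h : (l : ℕ) = j
    · have hlj : l = j := Fin.ext h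
      have := i'.isLt.ne'
      simp only [if_true, this, false_or, hlj, and_true]
      exact ⟨fun h => Fin.ext h.symm, fun h => by rw [h]⟩
    · have hlj : l ≠ j := fun h' => h (by rw [h'])
      simp [h, hlj]
  rw [h₂]
  exact diminishing hmono hsub h₁ _

/-- The slots that are not yet filled in round `t` before position `j`, where the position `jstar`
uses the item of `o` throughout. -/
def Pending (o : Fin k → Fin K) (jstar : Fin k) (t j : ℕ) (T : Table n k) : Prop :=
  (∀ t', T t' jstar = o jstar) ∧ ∀ (t' : Fin n) (l : Fin k), l ≠ jstar →
    (t < t' ∨ (t' : ℕ) = t ∧ j ≤ (l : ℕ)) → T t' l = K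

/-- The potential function for one round. -/
noncomputable def potential (f : Finset (Fin K × Fin k) → ℝ) (o : Fin k → Fin K) (j : ℕ)
    (T : Table n k) : ℝ := average f T - 1 / n * increase f T (prefixPairs o j)

end Greedy

/-! ### Progress of the greedy rounds -/

section Rounds

variable {K k m n q : ℕ} {I : Instance K k m} {G : (Fin m → ℝ) → (Fin m → ℝ) → ℝ}
  {o : Fin k → Fin K} {jstar : Fin k} {T : Table n k} {M : ℝ}

theorem Pending.step {N t j : ℕ} (h : Pending o jstar t j T)
    (ω : Fin N → Fin k → Fin n) :
    Pending o jstar t (j + 1) (step I G jstar t j T ω) := by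
  unfold Algorithm.step
  split_ifs with hj
  · exact ⟨h.1, fun t' l hl ht => h.2 t' l hl (by omega)⟩
  · refine ⟨fun t' => ?_, fun t' l hl ht => ?_⟩
    · unfold Table.set
      rw [if_neg (fun hc => hj hc.2.symm)]
      exact h.1 t'
    · unfold Table.set
      rw [if_neg (by omega)]
      exact h.2 t' l hl (by omega)

theorem potential_step_le [NeZero n] (hq : 0 < q) (hG : IsMDR I G)
    (hnonneg : ∀ a : Fin k → ℕ, 0 ≤ I.partialValue G a)
    (hM : ∀ a : Fin k → ℕ, I.partialValue G a ≤ M) {t j : ℕ} (ht : t < n) (hj : j < k)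
    (hT : Pending o jstar t j T) :
    potential (I.setValue G) o j T - 1 / n * (K * M / q) ≤
      𝔼 ω : Fin (q ^ 2) → Fin k → Fin n,
        potential (I.setValue G) o (j + 1) (step I G jstar t j T ω) := by
  have hmono := hG.monotone
  have hsub := hG.submodular
  have hn : (0 : ℝ) < n := by exact_mod_cast NeZero.pos n
  have hM0 : 0 ≤ M := (hnonneg fun _ => 0).trans (hM _)
  by_cases hjs : j = jstar
  -- At the guessed position every random assignment already contains the pair of `o`, so extending
  -- the prefix changes nothing.
  · have h : ∀ ω : Fin (q ^ 2) → Fin k → Fin n,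
        potential (I.setValue G) o (j + 1) (step I G jstar t j T ω) =
          potential (I.setValue G) o j T := by
      intro ω
      rw [step, if_pos hjs]
      unfold potential
      congr 2
      refine Finset.expect_congr rfl fun x _ => ?_
      congr 2
      rw [prefixPairs_succ o hj, ← Finset.union_assoc]
      refine Finset.union_eq_left.2 (Finset.singleton_subset_iff.2 (Finset.mem_union_left _ ?_))
      obtain rfl : (⟨j, hj⟩ : Fin k) = jstar := Fin.ext hjs
      rw [mem_pairs]
      exact hT.1 _
    simp only [h, Fintype.expect_const]
    have : 0 ≤ 1 / (n : ℝ) * (K * M / q) := by positivity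
    linarith
  · have hTt : T ⟨t, ht⟩ ⟨j, hj⟩ = K :=
      hT.2 ⟨t, ht⟩ ⟨j, hj⟩ (fun h => hjs (by rw [← h])) (Or.inr ⟨rfl, le_rfl⟩)
    set c : (Fin (q ^ 2) → Fin k → Fin n) → ℕ := fun ω =>
      argmaxBelow (estimate I G T j ω) K with hc
    have hω : ∀ ω : Fin (q ^ 2) → Fin k → Fin n,
        potential (I.setValue G) o j T + 1 / n * (averageWith (I.setValue G) T j (c ω) -
          averageWith (I.setValue G) T j (o ⟨j, hj⟩)) ≤
        potential (I.setValue G) o (j + 1) (step I G jstar t j T ω) := by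
      intro ω
      rw [step, if_neg hjs]
      unfold potential
      have h₁ := average_set (f := I.setValue G) (t := ⟨t, ht⟩) (j := ⟨j, hj⟩) hTt (c ω)
      have h₂ := increase_anti_set hmono hsub (t := ⟨t, ht⟩) (j := ⟨j, hj⟩) hTt (c ω)
        (prefixPairs o (j + 1))
      have h₃ := increase_union_le (T := T) hmono hsub (prefixPairs o j)
        {(o ⟨j, hj⟩, ⟨j, hj⟩)}
      have h₄ := increase_singleton_le (T := T) hmono hsub (o ⟨j, hj⟩) ⟨j, hj⟩
      rw [← prefixPairs_succ o hj] at h₃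
      simp only at h₁ h₂ h₄
      -- Replacing the table by the fuller one and splitting off the new pair bounds the term
      -- subtracted in the potential. The gain over an empty position appears here and in `h₁`, so
      -- only the difference between the chosen item and that of `o` survives.
      have h₅ : increase (I.setValue G) (T.set t j (c ω)) (prefixPairs o (j + 1)) ≤
          increase (I.setValue G) T (prefixPairs o j) +
          (averageWith (I.setValue G) T j (o ⟨j, hj⟩) - averageWith (I.setValue G) T j K) := by
        linarith
      have h₆ := mul_le_mul_of_nonneg_left h₅ (show (0 : ℝ) ≤ 1 / n by positivity)
      linarith
    have hgood : averageWith (I.setValue G) T j (o ⟨j, hj⟩) - K * M / q ≤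
        𝔼 ω, averageWith (I.setValue G) T j (c ω) := by
      have := le_expect_argmaxBelow (K := K) (q := q) (M := M) (o := o ⟨j, hj⟩)
        (X := fun i (x : Fin k → Fin n) => I.partialValue G (pickWith T x j i))
        (fun _ _ => hnonneg _) (fun _ _ => hM _) hq (o ⟨j, hj⟩).isLt
      simp only [partialValue_eq_setValue] at this
      have he : ∀ ω : Fin (q ^ 2) → Fin k → Fin n, estimate I G T j ω =
          fun i => ∑ r, I.setValue G (pairs K (pickWith T (ω r) j i)) := fun ω => by
        funext i; simp only [estimate, partialValue_eq_setValue]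
      simpa only [hc, he, averageWith] using this
    have := Finset.expect_le_expect (s := Finset.univ) fun ω _ => hω ω
    rw [Finset.expect_add_distrib, Fintype.expect_const, ← Finset.mul_expect,
      Finset.expect_sub_distrib, Fintype.expect_const] at this
    have h₇ := mul_le_mul_of_nonneg_left hgood (show (0 : ℝ) ≤ 1 / n by positivity)
    linarith

/-- The potential starts at the old average and loses only sampling errors. At the end of the round
its subtracted term is `1/n` times the gain from adding all pairs of `o`, which is at least the
value of `o` minus the new average. Measuring this gain at the new table produces the factor `1 +
1/n` on the right. -/
theorem average_round_le [NeZero n] (hq : 0 < q) (hG : IsMDR I G)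
    (hnonneg : ∀ a : Fin k → ℕ, 0 ≤ I.partialValue G a)
    (hM : ∀ a : Fin k → ℕ, I.partialValue G a ≤ M) {t : ℕ} (ht : t < n)
    (hT : Pending o jstar t 0 T) :
    average (I.setValue G) T + 1 / n * I.partialValue G (fun l => (o l : ℕ)) -
        1 / n * (k * (K * M / q)) ≤
      (1 + 1 / n) * 𝔼 ω : Fin k → Fin (q ^ 2) → Fin k → Fin n,
        average (I.setValue G) (fold (step I G jstar t) k T ω) := by
  have hmono := hG.monotone
  have h := le_expect_fold (f := step I G jstar t) (Pending o jstar t)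
    (potential (I.setValue G) o) (1 / n * (K * M / q)) (fun j _ T ω h => h.step ω)
    (fun j hj T h => potential_step_le hq hG hnonneg hM ht hj h) hT
  have h₀ : potential (I.setValue G) o 0 T = average (I.setValue G) T := by
    have : prefixPairs o 0 = ∅ := by ext; simp [prefixPairs]
    simp [potential, increase, this]
  have h₁ : ∀ T : Table n k, potential (I.setValue G) o k T ≤
      (1 + 1 / n) * average (I.setValue G) T -
        1 / n * I.partialValue G (fun l => (o l : ℕ)) := by
    intro T
    have : I.partialValue G (fun l => (o l : ℕ)) - average (I.setValue G) T ≤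
        increase (I.setValue G) T (prefixPairs o k) := by
      rw [increase, Finset.expect_sub_distrib, ← average]
      refine sub_le_sub_right (Finset.le_expect Finset.univ_nonempty fun x _ => ?_) _
      rw [partialValue_eq_setValue, prefixPairs_full]
      exact hmono Finset.subset_union_right
    have := mul_le_mul_of_nonneg_left this (show (0 : ℝ) ≤ 1 / n by positivity)
    unfold potential
    linarith
  have h₂ := h.trans (Finset.expect_le_expect fun ω _ => h₁ _)
  rw [h₀, Finset.expect_sub_distrib, Fintype.expect_const, ← Finset.mul_expect] at h₂
  linarith

/-- Having passed every position in round `t` is the same as standing before position `0` in round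
`t + 1`. -/
theorem Pending.round {N t : ℕ} (h : Pending o jstar t 0 T)
    (ω : Fin k → Fin N → Fin k → Fin n) :
    Pending o jstar (t + 1) 0 (fold (Algorithm.step I G jstar t) k T ω) := by
  have := fold_induction (f := Algorithm.step I G jstar t) (Pending o jstar t)
    (fun j _ T x h => h.step x) h ω
  exact ⟨this.1, fun t' l hl ht => this.2 t' l hl (by omega)⟩

/-- The rescaled gap `c ^ t * (average - M)` with `c = 1 + 1/n` loses only sampling errors per
round. Bounding each factor `c ^ t` by `c ^ n` lets the final division by `c ^ n` restore the plain
total error. -/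
theorem average_finalTable_le [NeZero n] (hq : 0 < q) (hG : IsMDR I G)
    (hnonneg : ∀ a : Fin k → ℕ, 0 ≤ I.partialValue G a)
    (hM : ∀ a : Fin k → ℕ, I.partialValue G a ≤ I.partialValue G (fun l => (o l : ℕ)))
    (hM' : I.partialValue G (fun l => (o l : ℕ)) = M) :
    M - (M - average (I.setValue G) (start K n k (o jstar, jstar))) / (1 + 1 / n) ^ n -
        k * (K * M / q) ≤
      𝔼 ω : Fin n → Fin k → Fin (q ^ 2) → Fin k → Fin n,
        average (I.setValue G) (finalTable I G n (o jstar, jstar) ω) := by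
  have hn : (0 : ℝ) < n := by exact_mod_cast NeZero.pos n
  have hM0 : 0 ≤ M := hM' ▸ hnonneg _
  set c : ℝ := 1 + 1 / n with hc
  have hc1 : 1 ≤ c := by rw [hc]; have : (0 : ℝ) ≤ 1 / n := by positivity
                         linarith
  have hc0 : 0 < c := by linarith
  have h := le_expect_fold (Ω := Fin k → Fin (q ^ 2) → Fin k → Fin n) (n := n)
    (f := fun t => fold (step I G jstar t) k)
    (b := start K n k (o jstar, jstar))
    (fun t T => Pending o jstar t 0 T)
    (fun t T => c ^ t * (average (I.setValue G) T - M)) (c ^ n * (1 / n * (k * (K * M / q))))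
    (fun t _ T ω h => h.round ω) ?_ ?_
  · simp only [pow_zero, one_mul, ← Finset.mul_expect, Finset.expect_sub_distrib,
      Fintype.expect_const] at h
    change _ ≤ c ^ n * ((𝔼 ω : Fin n → Fin k → Fin (q ^ 2) → Fin k → Fin n,
        average (I.setValue G) (finalTable I G n (o jstar, jstar) ω)) - M) at h
    have hcn : 0 < c ^ n := pow_pos hc0 n
    rw [← div_le_iff₀' hcn, sub_div] at h
    have e : (n : ℝ) * (c ^ n * (1 / n * (k * (K * M / q)))) / c ^ n = k * (K * M / q) := by
      field_simp
    rw [e] at h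
    rw [← neg_sub M, neg_div] at h
    linarith
  · intro t ht T hT
    have := average_round_le hq hG hnonneg (M := M) (fun a => hM' ▸ hM a) ht hT
    rw [hM', ← hc] at this
    simp only [← Finset.mul_expect, Finset.expect_sub_distrib, Fintype.expect_const]
    set A := 𝔼 ω : Fin k → Fin (q ^ 2) → Fin k → Fin n,
        average (I.setValue G) (fold (step I G jstar t) k T ω)
    have h₁ := mul_le_mul_of_nonneg_left this (pow_pos hc0 t).le
    have h₂ : c ^ t * (1 / n * (k * (K * M / q))) ≤ c ^ n * (1 / n * (k * (K * M / q))) :=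
      mul_le_mul_of_nonneg_right (pow_le_pow_right₀ hc1 ht.le) (by positivity)
    have h₃ : c ^ (t + 1) * M = c ^ t * (M + 1 / n * M) := by rw [pow_succ, hc]; ring
    have h₄ : c ^ (t + 1) * A = c ^ t * (c * A) := by rw [pow_succ]; ring
    rw [mul_sub, mul_sub, h₃, h₄]
    linarith
  · refine ⟨fun t' => by simp [start], fun t' l hl _ => by simp [start, hl]⟩

end Rounds

/-! ### Success probability of a trial -/

section Success

variable {K k m n q : ℕ} {I : Instance K k m} {G : (Fin m → ℝ) → (Fin m → ℝ) → ℝ}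

/-- The value of the empty set is `G(p, 0)`, and zero is a subdistribution; monotonicity extends
nonnegativity to all assignments. -/
theorem partialValue_nonneg (hG : IsMDR I G) (a : Fin k → ℕ) : 0 ≤ I.partialValue G a := by
  have h0 : 0 ≤ I.setValue G ∅ := by
    refine hG.nonneg _ I.target_mem _ ⟨fun g => ?_, ?_⟩ <;> simp [itemsUpTo]
  rw [partialValue_eq_setValue]
  exact h0.trans (hG.monotone (Finset.empty_subset _))

/-- Subadditivity over the at most `k ≤ K` pairs of `o`, and averaging. -/
theorem exists_valuable_pair (hkK : k ≤ K) (hk : 0 < k) (hG : IsMDR I G) (o : Fin k → Fin K) :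
    ∃ j, I.partialValue G (fun l => (o l : ℕ)) / K ≤ I.setValue G {(o j, j)} := by
  set S := pairs K fun l => (o l : ℕ) with hS
  have hne : S.Nonempty := ⟨(o ⟨0, hk⟩, ⟨0, hk⟩), by rw [hS, mem_pairs]⟩
  have hcard : S.card ≤ k := by
    have := Finset.card_le_card_of_injOn (s := S) (t := Finset.univ) Prod.snd (by simp) (by
      intro e he e' he' h
      rw [Finset.mem_coe, hS, mem_pairs] at he he'
      refine Prod.ext (Fin.ext ?_) h
      rw [← he, ← he', h])
    simpa using this
  have hnonneg := partialValue_nonneg hG fun l => (o l : ℕ)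
  have hK : (0 : ℝ) < K := by exact_mod_cast hk.trans_le hkK
  have h0 : 0 ≤ I.setValue G ∅ := by
    have := partialValue_nonneg hG fun _ : Fin k => K
    rw [partialValue_eq_setValue] at this
    have he : pairs K (fun _ : Fin k => K) = ∅ :=
      Finset.eq_empty_of_forall_notMem fun e he => by
        rw [mem_pairs] at he; exact e.1.isLt.ne he.symm
    rwa [he] at this
  have hsum := le_sum_singletons hG.monotone hG.submodular h0 hne
  rw [← partialValue_eq_setValue] at hsum
  obtain ⟨⟨i, j⟩, he, h⟩ := Finset.exists_le_of_sum_le hne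
    (f := fun _ => I.partialValue G (fun l => (o l : ℕ)) / K)
    (g := fun e => I.setValue G {e}) (by
      refine le_trans ?_ hsum
      rw [Finset.sum_const, nsmul_eq_mul, mul_div_assoc', div_le_iff₀ hK, mul_comm]
      exact mul_le_mul_of_nonneg_left (by exact_mod_cast hcard.trans hkK) hnonneg)
  rw [hS, mem_pairs] at he
  obtain rfl : o j = i := Fin.ext he
  exact ⟨j, h⟩

/-- The inequality `1 - 1/(n+1) ≤ exp(-1/(n+1))` is used twice: its `n`-th power yields `exp(-1) *
exp(1/(n+1))`, and its reciprocal bounds the second factor by `1 + 1/n`. -/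
theorem inv_one_add_inv_pow_le {n : ℕ} (hn : 0 < n) :
    1 / (1 + 1 / (n : ℝ)) ^ n ≤ 1 / Real.exp 1 * (1 + 1 / n) := by
  have hn' : (0 : ℝ) < n := by exact_mod_cast hn
  have h : 1 / (1 + 1 / (n : ℝ)) ≤ Real.exp (-(1 / (n + 1))) := by
    have := Real.add_one_le_exp (-(1 / ((n : ℝ) + 1)))
    refine le_trans (le_of_eq ?_) this
    field_simp
    ring
  have h' : 1 + 1 / (n : ℝ) = 1 / (1 / (1 + 1 / (n : ℝ))) := by simp
  calc 1 / (1 + 1 / (n : ℝ)) ^ n = (1 / (1 + 1 / (n : ℝ))) ^ n := by rw [one_div_pow]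
    _ ≤ Real.exp (-(1 / (n + 1))) ^ n := pow_le_pow_left₀ (by positivity) h n
    _ = 1 / Real.exp 1 * Real.exp (1 / (n + 1)) := by
        rw [← Real.exp_nat_mul, one_div (Real.exp 1), ← Real.exp_neg, ← Real.exp_add]
        congr 1
        field_simp
        ring
    _ ≤ _ := by
        refine mul_le_mul_of_nonneg_left ?_ (by positivity)
        rw [h', le_one_div (Real.exp_pos _) (by positivity), one_div (Real.exp _),
          ← Real.exp_neg]
        exact h

theorem one_third_le_inv_exp : 1 / 3 ≤ 1 / Real.exp 1 :=
  one_div_le_one_div_of_le (Real.exp_pos 1) (Real.exp_one_lt_d9.le.trans (by norm_num))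

theorem inv_exp_le_half : 1 / Real.exp 1 ≤ 1 / 2 :=
  one_div_le_one_div_of_le (by norm_num) ((by norm_num : (2 : ℝ) ≤ 2.7182818283).trans
    Real.exp_one_gt_d9.le)

theorem ratio_le (hkK : k ≤ K) (hK : 0 < K) {M A : ℝ} (hM : 0 ≤ M) (hA : M / K ≤ A)
    (hn : n = 24 * K ^ 3) :
    (1 - 1 / Real.exp 1 + 1 / (4 * K)) * M ≤
      M - (M - A) / (1 + 1 / (n : ℝ)) ^ n - k * (K * M / n) := by
  have hK' : (1 : ℝ) ≤ K := by exact_mod_cast hK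
  have hkK' : (k : ℝ) ≤ K := by exact_mod_cast hkK
  have hnpos : 0 < n := by rw [hn]; positivity
  have hn' : (n : ℝ) = 24 * K ^ 3 := by rw [hn]; push_cast; ring
  set x : ℝ := 1 / K with hx
  have hx0 : 0 < x := by positivity
  have hx1 : x ≤ 1 := by rw [hx, div_le_one (by linarith)]; exact hK'
  have hinv : 1 / (n : ℝ) ≤ x / 24 := by
    rw [hn', hx, div_div, mul_comm]
    refine one_div_le_one_div_of_le (by positivity) ?_
    nlinarith [pow_le_pow_right₀ hK' (show 1 ≤ 3 by norm_num)]
  have h₁ : (M - A) / (1 + 1 / (n : ℝ)) ^ n ≤ 1 / Real.exp 1 * (1 - 23 / 24 * x) * M := by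
    calc (M - A) / (1 + 1 / (n : ℝ)) ^ n = (M - A) * (1 / (1 + 1 / (n : ℝ)) ^ n) := by ring
      _ ≤ ((1 - x) * M) * (1 / (1 + 1 / (n : ℝ)) ^ n) := by
          refine mul_le_mul_of_nonneg_right ?_ (by positivity)
          have : M / K = x * M := by rw [hx]; ring
          linarith
      _ ≤ ((1 - x) * M) * (1 / Real.exp 1 * (1 + 1 / n)) :=
          mul_le_mul_of_nonneg_left (inv_one_add_inv_pow_le hnpos)
            (mul_nonneg (by linarith) hM)
      _ ≤ ((1 - x) * M) * (1 / Real.exp 1 * (1 + x / 24)) := by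
          refine mul_le_mul_of_nonneg_left ?_ (mul_nonneg (by linarith) hM)
          exact mul_le_mul_of_nonneg_left (by linarith) (by positivity)
      _ = 1 / Real.exp 1 * ((1 - x) * (1 + x / 24)) * M := by ring
      _ ≤ _ := by
          refine mul_le_mul_of_nonneg_right ?_ hM
          refine mul_le_mul_of_nonneg_left ?_ (by positivity)
          nlinarith
  have h₂ : k * (K * M / n) ≤ x / 24 * M := by
    have : x / 24 * M = K * (K * M / n) := by
      rw [hn', hx]; field_simp
    rw [this]
    exact mul_le_mul_of_nonneg_right hkK' (by positivity)
  have h₃ : 1 / (4 * (K : ℝ)) = x / 4 := by rw [hx]; field_simp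
  have h₄ := one_third_le_inv_exp
  have h₅ : 1 / 3 * (x * M) ≤ 1 / Real.exp 1 * (x * M) :=
    mul_le_mul_of_nonneg_right h₄ (by positivity)
  have h₆ : 0 ≤ x * M := by positivity
  rw [h₃]
  -- With `x = 1/K`, the guess gains `23x/24` times `1/e ≥ 1/3`, and sampling costs `x/24`; the
  -- remainder `20x/72` exceeds `x/4`.
  linarith

theorem expect_trialValue [NeZero n] {N : ℕ} (p : Fin K × Fin k) :
    𝔼 ω : (Fin n → Fin k → Fin N → Fin k → Fin n) × (Fin k → Fin n),
      trialValue I G ((p, ω.1), ω.2) =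
    𝔼 ω, average (I.setValue G) (finalTable (N := N) I G n p ω) := by
  rw [expect_prod]
  simp only [average, trialValue, partialValue_eq_setValue]

theorem le_expect_trialValue [NeZero n] (hkK : k ≤ K) (hk : 0 < k) (hG : IsMDR I G)
    (hn : n = 24 * K ^ 3) {o : Fin k → Fin K}
    (hM : ∀ a : Fin k → ℕ, I.partialValue G a ≤ I.partialValue G (fun l => (o l : ℕ))) :
    ∃ p : Fin K × Fin k,
      (1 - 1 / Real.exp 1 + 1 / (4 * K)) * I.partialValue G (fun l => (o l : ℕ)) ≤
      𝔼 ω : (Fin n → Fin k → Fin (n ^ 2) → Fin k → Fin n) × (Fin k → Fin n),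
        trialValue I G ((p, ω.1), ω.2) := by
  obtain ⟨j, hj⟩ := exists_valuable_pair hkK hk hG o
  refine ⟨(o j, j), ?_⟩
  rw [expect_trialValue]
  refine le_trans ?_ (average_finalTable_le (NeZero.pos n) hG (partialValue_nonneg hG) hM rfl)
  refine ratio_le hkK (hk.trans_le hkK) (partialValue_nonneg hG _) (hj.trans ?_) hn
  refine Finset.le_expect Finset.univ_nonempty fun x _ => hG.monotone ?_
  rw [Finset.singleton_subset_iff, mem_pairs]
  simp [pick, start]

open Classical in
/-- A trial is successful with probability at least `1 / (8 K³)`. -/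
theorem le_expect_success [NeZero n] (hkK : k ≤ K) (hk : 0 < k) (hG : IsMDR I G)
    (hn : n = 24 * K ^ 3) {o : Fin k → Fin K}
    (hM : ∀ a : Fin k → ℕ, I.partialValue G a ≤ I.partialValue G (fun l => (o l : ℕ))) :
    1 / (8 * (K : ℝ) ^ 3) ≤ 𝔼 ω : Choices K k n (n ^ 2),
      if (1 - 1 / Real.exp 1 + 1 / (8 * K)) * I.partialValue G (fun l => (o l : ℕ)) ≤
        trialValue I G ω then 1 else 0 := by
  have hK : 0 < K := hk.trans_le hkK
  have hK' : (1 : ℝ) ≤ K := by exact_mod_cast hK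
  have hk' : (0 : ℝ) < k := by exact_mod_cast hk
  have hkK' : (k : ℝ) ≤ K := by exact_mod_cast hkK
  have : NeZero K := ⟨hK.ne'⟩
  have : NeZero k := ⟨hk.ne'⟩
  obtain ⟨p, hp⟩ := le_expect_trialValue hkK hk hG hn hM
  have hM0 := partialValue_nonneg hG fun l => (o l : ℕ)
  set M := I.partialValue G fun l => (o l : ℕ)
  set θ := (1 - 1 / Real.exp 1 + 1 / (8 * K)) * M with hθ
  have hθ0 : 0 ≤ θ := by
    have := inv_exp_le_half
    have : (0 : ℝ) ≤ 1 / (8 * K) := by positivity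
    exact mul_nonneg (by linarith) hM0
  set g : Choices K k n (n ^ 2) → ℝ := fun ω => if θ ≤ trialValue I G ω then 1 else 0 with hg
  have hg0 : ∀ ω, 0 ≤ g ω := fun ω => by simp only [hg]; split_ifs <;> norm_num
  have hcond : 1 / (8 * (K : ℝ)) ≤
      𝔼 ω : (Fin n → Fin k → Fin (n ^ 2) → Fin k → Fin n) × (Fin k → Fin n),
        g ((p, ω.1), ω.2) := by
    -- If `M = 0` every trial succeeds; otherwise division by `M` is possible.
    rcases hM0.eq_or_lt with h0 | hpos
    · have : ∀ ω, g ω = 1 := fun ω => by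
        simp only [hg]
        rw [if_pos]
        rw [hθ, ← h0, mul_zero]
        exact partialValue_nonneg hG _
      simp only [this, Fintype.expect_const]
      rw [div_le_one (by positivity)]
      linarith
    -- Reverse Markov inequality: a trial is worth less than `θ` if it fails and at most `M`
    -- otherwise, while the mean exceeds `θ` by at least `M/(8K)`.
    · have h : ∀ ω, trialValue I G ω ≤ θ + M * g ω := by
        intro ω
        simp only [hg]
        split_ifs with h
        · have : trialValue I G ω ≤ M := hM _
          linarith
        · linarith [not_le.1 h]
      have h' := hp.trans (Finset.expect_le_expect fun ω _ => h _)
      rw [Finset.expect_add_distrib, Fintype.expect_const, ← Finset.mul_expect] at h'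
      have e : (1 - 1 / Real.exp 1 + 1 / (4 * K)) * M = θ + M * (1 / (8 * K)) := by
        rw [hθ]; field_simp; ring
      rw [e] at h'
      exact le_of_mul_le_mul_left (by linarith) hpos
  have hsplit : 𝔼 ω, g ω = 𝔼 p : Fin K × Fin k,
      𝔼 ω : (Fin n → Fin k → Fin (n ^ 2) → Fin k → Fin n) × (Fin k → Fin n),
        g ((p, ω.1), ω.2) := by
    rw [expect_prod, expect_prod]
    simp only [expect_prod]
  rw [hsplit, Fintype.expect_eq_sum_div_card]
  -- Only the right guess is credited; it has probability `1/(K k) ≥ 1/K²`.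
  have hsingle := Finset.single_le_sum (s := Finset.univ) (a := p)
    (f := fun p : Fin K × Fin k =>
      𝔼 ω : (Fin n → Fin k → Fin (n ^ 2) → Fin k → Fin n) × (Fin k → Fin n), g ((p, ω.1), ω.2))
    (fun p _ => Finset.expect_nonneg fun ω _ => hg0 _) (Finset.mem_univ p)
  have hle := hcond.trans hsingle
  rw [le_div_iff₀ (by simp [hK, hk])]
  refine le_trans ?_ hle
  simp only [Fintype.card_prod, Fintype.card_fin, Nat.cast_mul]
  rw [div_mul_eq_mul_div, one_mul, div_le_div_iff₀ (by positivity) (by positivity)]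
  nlinarith [mul_le_mul_of_nonneg_left hkK' (show (0 : ℝ) ≤ K ^ 2 by positivity)]

/-- The exponent is `n² / (8K³) = 576 K⁶ / (8K³)`. -/
theorem one_sub_pow_le (hK : 0 < K) (hn : n = 24 * K ^ 3) :
    (1 - 1 / (8 * (K : ℝ) ^ 3)) ^ n ^ 2 ≤ Real.exp (-(72 * K ^ 3)) := by
  have hK' : (1 : ℝ) ≤ K := by exact_mod_cast hK
  have hK3 : (1 : ℝ) ≤ K ^ 3 := one_le_pow₀ hK'
  calc (1 - 1 / (8 * (K : ℝ) ^ 3)) ^ n ^ 2 ≤ Real.exp (-(1 / (8 * (K : ℝ) ^ 3))) ^ n ^ 2 := by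
        refine pow_le_pow_left₀ ?_ (Real.one_sub_le_exp_neg _) _
        rw [sub_nonneg, div_le_one (by positivity)]
        linarith
    _ = _ := by
        rw [← Real.exp_nat_mul]
        congr 1
        rw [hn]
        push_cast
        field_simp
        norm_num

theorem exp_le_half_pow (hK : 0 < K) : Real.exp (-(72 * (K : ℝ) ^ 3)) ≤ (1 / 2) ^ K := by
  have hK' : (1 : ℝ) ≤ K := by exact_mod_cast hK
  have : (K : ℝ) ≤ K ^ 3 := le_self_pow₀ hK' (by norm_num)
  calc Real.exp (-(72 * (K : ℝ) ^ 3)) ≤ Real.exp (K * (-1)) := Real.exp_le_exp.2 (by linarith)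
    _ = (1 / Real.exp 1) ^ K := by rw [Real.exp_nat_mul, Real.exp_neg, one_div]
    _ ≤ _ := pow_le_pow_left₀ (by positivity) inv_exp_le_half K

theorem exp_le_inv (hK : 0 < K) : Real.exp (-(72 * (K : ℝ) ^ 3)) ≤ 1 / (16 * K) := by
  have hK' : (1 : ℝ) ≤ K := by exact_mod_cast hK
  have h : (K : ℝ) ≤ K ^ 3 := le_self_pow₀ hK' (by norm_num)
  rw [Real.exp_neg, ← one_div]
  refine one_div_le_one_div_of_le (by positivity) ?_
  have := Real.add_one_le_exp (72 * (K : ℝ) ^ 3)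
  linarith

end Success

/-! ### Probabilities as averages and independent repetition -/

section Repetition

theorem sum_uniform_map {α β : Type} [Fintype α] [Nonempty α] [Fintype β] (g : α → β)
    (φ : β → ℝ) :
    ∑ b, (((PMF.uniformOfFintype α).map g) b).toReal * φ b = 𝔼 a, φ (g a) := by
  classical
  have h : ∀ b, (((PMF.uniformOfFintype α).map g) b).toReal =
      ∑ a, if b = g a then (Fintype.card α : ℝ)⁻¹ else 0 := by
    intro b
    rw [PMF.map_apply, tsum_fintype, ENNReal.toReal_sum]
    · refine Finset.sum_congr rfl fun a _ => ?_
      split_ifs <;> simp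
    · intro a _
      split_ifs <;> simp
  simp_rw [h, Finset.sum_mul]
  rw [Finset.sum_comm, Fintype.expect_eq_sum_div_card, Finset.sum_div]
  refine Finset.sum_congr rfl fun a _ => ?_
  simp [div_eq_mul_inv, mul_comm]

open Classical in
theorem toOuterMeasure_uniform_map {α β : Type} [Fintype α] [Nonempty α] [Fintype β] (g : α → β)
    (S : Set β) :
    (((PMF.uniformOfFintype α).map g).toOuterMeasure S).toReal =
      𝔼 a, if g a ∈ S then (1 : ℝ) else 0 := by
  rw [PMF.toOuterMeasure_apply_fintype, ENNReal.toReal_sum, ← sum_uniform_map g fun b =>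
    if b ∈ S then (1 : ℝ) else 0]
  · refine Finset.sum_congr rfl fun b _ => ?_
    by_cases h : b ∈ S <;> simp [h]
  · intro b _
    by_cases h : b ∈ S
    · simp only [h, Set.indicator_of_mem]
      exact PMF.apply_ne_top _ _
    · simp [h]

open Classical in
/-- The probability that one of `N` independent trials succeeds. -/
theorem le_expect_exists {Ω : Type} [Fintype Ω] [Nonempty Ω] {S : Set Ω} {p : ℝ}
    (hp : p ≤ 𝔼 x, if x ∈ S then (1 : ℝ) else 0) (N : ℕ) :
    1 - (1 - p) ^ N ≤ 𝔼 ω : Fin N → Ω, if ∃ r, ω r ∈ S then (1 : ℝ) else 0 := by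
  have h : ∀ ω : Fin N → Ω, (if ∃ r, ω r ∈ S then (1 : ℝ) else 0) =
      1 - ∏ r, (1 - if ω r ∈ S then (1 : ℝ) else 0) := by
    intro ω
    split_ifs with h
    · obtain ⟨r, hr⟩ := h
      rw [Finset.prod_eq_zero (Finset.mem_univ r) (by simp [hr]), sub_zero]
    · push Not at h
      simp [h]
  simp only [h]
  rw [Finset.expect_sub_distrib, Fintype.expect_const]
  have hpow := Finset.expect_pow Finset.univ (fun x => 1 - if x ∈ S then (1 : ℝ) else 0) N
  rw [Fintype.piFinset_univ] at hpow
  rw [← hpow, Finset.expect_sub_distrib, Fintype.expect_const]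
  refine sub_le_sub_left (pow_le_pow_left₀ ?_ (by linarith) N) 1
  rw [sub_nonneg]
  refine Finset.expect_le Finset.univ_nonempty fun x _ => ?_
  split_ifs <;> norm_num

end Repetition

/-! ### Computing the parameters in polynomial time -/

namespace Algorithm

/-- A fixed multiple of an integer expression. -/
def multiple (e : NExpr) : ℕ → NExpr
  | 0 => .lit 0
  | c + 1 => .add (multiple e c) e

theorem eval_multiple (s : State) (e : NExpr) (c : ℕ) :
    (multiple e c).eval s = c * e.eval s := by
  induction c with
  | zero => simp [multiple, NExpr.eval]
  | succ c ih => simp [multiple, NExpr.eval, ih, Nat.succ_mul]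

/-- Compute the number `24 K³` of slots. -/
def countSlots : Program :=
  .seq (.loop 38 .items (.setNat 12 (.lit 0) (.lit 0) (.add (.cell 12) .items)))
    (.seq (.loop 39 .items (.setNat 13 (.lit 0) (.lit 0) (.add (.cell 13) (.cell 12))))
      (.setNat 10 (.lit 0) (.lit 0) (multiple (.cell 13) 24)))

/-- Compute the number of samples, which is the square of the number of slots. -/
def countSamples : Program :=
  .loop 40 (.cell 10) (.setNat 11 (.lit 0) (.lit 0) (.add (.cell 11) (.cell 10)))

def calibrate : Program := .seq countSlots (.seq countSamples searchLists)

variable {K k m n N : ℕ} {I : Instance K k m} {G : (Fin m → ℝ) → (Fin m → ℝ) → ℝ} {s : State}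
  {O : (ℕ → ℝ) → ℝ}

/-- Integers cannot be multiplied directly, so powers of `K` arise by repeated addition. All of row
`0` is described because the step bounds are stated for whole rows. -/
theorem computes_countSlots (I : Instance K k m) :
    Computes O countSlots I.initial fun s =>
      ∀ j, s.nat 10 0 j = if j = 0 then 24 * K ^ 3 else 0 := by
  have hK : I.initial.nat 0 0 0 = K := by simp [Instance.initial]
  have h0 : ∀ a j, a ≠ 0 → I.initial.nat a 0 j = 0 := by
    intro a j ha; simp [Instance.initial, ha]
  refine Computes.seq (computes_loop (n := K) (by exact hK)
    (fun t s => s.nat 12 0 0 = t * K) (by simp [h0]) ?_) ?_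
  · intro t _ s hF hI
    refine computes_setNat ?_
    have : s.nat 0 0 0 = K := by rw [hF.nat 0 (by decide), hK]
    simp [NExpr.eval, hI, this, Nat.succ_mul]
  intro s₁ hF₁ h₁
  have hK₁ : s₁.nat 0 0 0 = K := by rw [hF₁.nat 0 (by decide), hK]
  refine Computes.seq (computes_loop (n := K) (by exact hK₁)
    (fun t s => s.nat 13 0 0 = t * (K * K))
    (by simp [hF₁.nat 13 (by decide), h0]) ?_) ?_
  · intro t _ s hF hI
    refine computes_setNat ?_
    have : s.nat 12 0 0 = K * K := by rw [hF.nat 12 (by decide), h₁]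
    simp [NExpr.eval, hI, this, Nat.succ_mul]
  intro s₂ hF₂ h₂
  refine computes_setNat fun j => ?_
  simp only [NExpr.eval, eval_multiple, h₂, State.tick_nat, State.writeNat_nat, true_and]
  split_ifs with hj
  · ring
  · rw [hF₂.nat 10 (by decide), hF₁.nat 10 (by decide), h0 _ _ (by decide)]

theorem computes_countSamples (h10 : s.nat 10 0 0 = n) (h11 : ∀ j, s.nat 11 0 j = 0) :
    Computes O countSamples s fun s' => ∀ j, s'.nat 11 0 j = if j = 0 then n ^ 2 else 0 := by
  refine (computes_loop (n := n) (by exact h10)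
    (fun t s' => ∀ j, s'.nat 11 0 j = if j = 0 then t * n else 0) (by simp [h11]) ?_).mono ?_
  · intro t _ s₁ hF hI
    refine computes_setNat fun j => ?_
    have : s₁.nat 10 0 0 = n := by rw [hF.nat 10 (by decide), h10]
    by_cases hj : j = 0 <;> simp [NExpr.eval, State.writeNat_nat, hI, this, hj, Nat.succ_mul]
  · intro s' _ h' j
    rw [h' j, sq]

/-- The loop bounds of the algorithm, for `K + k + m = x`. -/
def loopBound {S : Type} [Semiring S] (x : S) (a _j : ℕ) : S :=
  if a = 0 then x else if a = 10 then 24 * x ^ 3 else if a = 11 then (24 * x ^ 3) ^ 2 else 0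

theorem time_le_cost (hK : K ≤ m) (c : Program) {B : Finset ℕ} (hB : B ⊆ {0, 10, 11})
    (hl : c.LoopsOver B) (hw : Disjoint B c.natWrites) {s s' : State}
    (h0 : ∀ j, s.nat 0 0 j ≤ m)
    (h10 : 10 ∈ B → ∀ j, s.nat 10 0 j = if j = 0 then 24 * K ^ 3 else 0)
    (h11 : 11 ∈ B → ∀ j, s.nat 11 0 j = if j = 0 then (24 * K ^ 3) ^ 2 else 0)
    (hs : s' ∈ (c.run O s).support) : s'.time ≤ s.time + c.cost (loopBound m) := by
  have h := Program.time_le (v := fun a j => if a ∈ B then s.nat a 0 j else 0) hl hw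
    (fun a ha => by funext j; simp [ha]) hs
  refine h.trans (Nat.add_le_add_left (Program.cost_mono (fun a j => ?_) c) _)
  split_ifs with ha
  · have := hB ha
    simp only [Finset.mem_insert, Finset.mem_singleton] at this
    rcases this with rfl | rfl | rfl
    · simpa [loopBound] using h0 j
    · rw [h10 ha, show loopBound m 10 j = 24 * m ^ 3 by simp [loopBound]]
      split_ifs
      · gcongr
      · exact Nat.zero_le _
    · rw [h11 ha, show loopBound m 11 j = (24 * m ^ 3) ^ 2 by simp [loopBound]]
      split_ifs
      · gcongr
      · exact Nat.zero_le _
  · exact Nat.zero_le _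

theorem eval_loopBound (x a j : ℕ) :
    (loopBound (Polynomial.X : Polynomial ℕ) a j).eval x = loopBound x a j := by
  unfold loopBound
  split_ifs <;> simp

end Algorithm

/-! ### The complete algorithm and its guarantees -/

variable {K k m n : ℕ} {I : Instance K k m} {G : (Fin m → ℝ) → (Fin m → ℝ) → ℝ}

theorem Instance.positions_pos (I : Instance K k m) : 0 < k := by
  rcases Nat.eq_zero_or_pos k with rfl | h
  · have := I.weight_sum
    simp at this
  · exact h

theorem run_calibrate [NeZero K] [NeZero k] [NeZero n] [NeZero (n ^ 2)] (hkK : k ≤ K)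
    (hG : IsSMDR I G) (hn : n = 24 * K ^ 3) :
    (∀ s ∈ (calibrate.run (I.oracle G) I.initial).support,
      s.time ≤ calibrate.cost (loopBound (K + k + m))) ∧
    Realizes (I.oracle G) (Ω := Fin (n ^ 2) → Choices K k n (n ^ 2)) calibrate I.initial
      fun ω s => ∃ π : Fin k ↪ Fin K, (∀ l : Fin k, s.nat 1 0 l = π l) ∧
        ∀ r, trialValue I G (ω r) ≤ I.value G π := by
  obtain ⟨s₁, hs₁, hF₁, h₁⟩ := (computes_countSlots (O := I.oracle G) I).mono
    (Q := fun s => countSlots.Frame I.initial s ∧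
      ∀ j, s.nat 10 0 j = if j = 0 then 24 * K ^ 3 else 0) (fun s hF h => ⟨hF, h⟩)
  have h11 : ∀ j, s₁.nat 11 0 j = 0 := by
    intro j; rw [hF₁.nat 11 (by decide)]; simp [Instance.initial]
  have h10 : s₁.nat 10 0 0 = n := by rw [h₁, hn, if_pos rfl]
  obtain ⟨s₂, hs₂, hF₂, h₂⟩ := (computes_countSamples (O := I.oracle G) h10 h11).mono
    (Q := fun s => countSamples.Frame s₁ s ∧
      ∀ j, s.nat 11 0 j = if j = 0 then n ^ 2 else 0) (fun s hF h => ⟨hF, h⟩)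
  have hr : calibrate.run (I.oracle G) I.initial = searchLists.run (I.oracle G) s₂ := by
    simp [calibrate, Program.run, hs₁, hs₂]
  have e0 : s₂.nat 0 = I.initial.nat 0 := by
    rw [hF₂.nat 0 (by decide), hF₁.nat 0 (by decide)]
  have e10 : ∀ j, s₂.nat 10 0 j = if j = 0 then 24 * K ^ 3 else 0 := by
    rw [hF₂.nat 10 (by decide)]; exact h₁
  have hr0 : s₂.real = I.initial.real := by
    funext a
    rw [hF₂.real a (by simp [countSamples, Program.realWrites]),
      hF₁.real a (by simp [countSlots, Program.realWrites])]
  have hL : Loaded I n (n ^ 2) s₂ := by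
    constructor
    · rw [e0]; simp [Instance.initial]
    · rw [e0]; simp [Instance.initial]
    · rw [e0]; simp [Instance.initial]
    · rw [e10, hn, if_pos rfl]
    · rw [h₂, if_pos rfl]
    · intro l; rw [hr0]; simp [Instance.initial]
    · intro x g; rw [hr0]; simp [Instance.initial, Instance.item]
  constructor
  · intro s hs
    rw [hr] at hs
    have hi : ∀ j, I.initial.nat 0 0 j ≤ K + k + m := by
      intro j
      simp only [Instance.initial, and_self, if_true]
      split_ifs <;> omega
    -- The numbers of slots and samples are themselves computed, so no set of constant arrays serves
    -- the full program. Each phase is bounded separately, with those arrays as loop bounds that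
    -- earlier phases have completed.
    have t₁ := time_le_cost (O := I.oracle G) (K := K) (m := K + k + m) (by omega) countSlots
      (B := {0}) (by decide) (by simp [countSlots, Program.LoopsOver, NExpr.IsCell]) (by decide)
      hi (by simp) (by simp) (s' := s₁) (by simp [hs₁])
    have t₂ := time_le_cost (O := I.oracle G) (K := K) (m := K + k + m) (by omega) countSamples
      (B := {0, 10}) (by decide) (by simp [countSamples, Program.LoopsOver, NExpr.IsCell])
      (by decide) (s := s₁) (by rw [hF₁.nat 0 (by decide)]; exact hi) (fun _ => h₁) (by simp)
      (s' := s₂) (by simp [hs₂])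
    have t₃ := time_le_cost (O := I.oracle G) (K := K) (m := K + k + m) (by omega) searchLists
      (B := {0, 10, 11}) (by decide)
      (by simp [searchLists, trial, guess, resetTable, fillTable, fillEntry, addSamples, sample,
        tryItems, assign, evaluate, unmark, accumulate, findBest, finish, repair, search, record,
        Program.LoopsOver, NExpr.IsCell])
      (by decide) (s := s₂) (by rw [e0]; exact hi) (fun _ => e10) (fun _ j => by rw [h₂ j, hn]) hs
    have t₀ : I.initial.time = 0 := rfl
    simp only [calibrate, Program.cost]
    omega
  · have hnonneg : ∀ ω : Choices K k n (n ^ 2), 0 ≤ trialValue I G ω :=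
      fun ω => partialValue_nonneg hG.toIsMDR _
    obtain ⟨F, hF, hQ⟩ := realizes_searchLists hkK hG hL hnonneg
    exact ⟨F, by rw [hr, hF], hQ⟩

theorem exists_distribution (hkK : k ≤ K) (hG : IsSMDR I G) :
    (∀ s ∈ (calibrate.run (I.oracle G) I.initial).support,
      s.time ≤ calibrate.cost (loopBound (K + k + m))) ∧
    ∃ μ : PMF (Fin k ↪ Fin K),
      (calibrate.run (I.oracle G) I.initial).map (State.output k) =
        μ.map (fun π j => (π j : ℕ)) ∧
      (∀ π : Fin k ↪ Fin K,
        (1 - 1 / Real.exp 1) * I.value G π ≤ ∑ π', (μ π').toReal * I.value G π') ∧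
      1 - (1 / 2 : ℝ) ^ K ≤ (μ.toOuterMeasure {π' | ∀ π : Fin k ↪ Fin K,
        (1 - 1 / Real.exp 1) * I.value G π ≤ I.value G π'}).toReal := by
  classical
  have hk := I.positions_pos
  have hK : 0 < K := hk.trans_le hkK
  have hK' : (0 : ℝ) < K := by exact_mod_cast hK
  obtain ⟨n, hn⟩ : ∃ n, n = 24 * K ^ 3 := ⟨_, rfl⟩
  have hn0 : 0 < n := by rw [hn]; positivity
  have : NeZero K := ⟨hK.ne'⟩
  have : NeZero k := ⟨hk.ne'⟩
  have : NeZero n := ⟨hn0.ne'⟩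
  have : NeZero (n ^ 2) := ⟨(pow_pos hn0 2).ne'⟩
  obtain ⟨htime, F, hF, hQ⟩ := run_calibrate (n := n) hkK hG hn
  refine ⟨htime, ?_⟩
  choose π hπ hbest using hQ
  have : Nonempty (Fin k ↪ Fin K) := ⟨Fin.castLEEmb hkK⟩
  obtain ⟨o, ho⟩ := Finite.exists_max (fun π : Fin k ↪ Fin K => I.value G π)
  -- The best list is optimal even among assignments with repeated or missing items, so it can serve
  -- as the reference solution of the greedy analysis.
  have hM : ∀ a : Fin k → ℕ, I.partialValue G a ≤ I.partialValue G (fun l => (o l : ℕ)) := by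
    intro a
    obtain ⟨π, hπ⟩ := exists_list hkK a
    rw [partialValue_list]
    exact (partialValue_le hG hπ).trans (ho π)
  have hsuccess := le_expect_success hkK hk hG.toIsMDR hn hM
  rw [partialValue_list] at hsuccess
  have hvalue : ∀ π : Fin k ↪ Fin K, 0 ≤ I.value G π := fun π => by
    rw [← partialValue_list]; exact partialValue_nonneg hG.toIsMDR _
  set M := I.value G o with hMdef
  set θ := (1 - 1 / Real.exp 1 + 1 / (8 * K)) * M with hθ
  have he := inv_exp_le_half
  have he0 : 0 < 1 / Real.exp 1 := by positivity
  have hx : (0 : ℝ) < 1 / (8 * K) := by positivity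
  have hMθ : (1 - 1 / Real.exp 1) * M ≤ θ :=
    mul_le_mul_of_nonneg_right (by linarith) (hvalue o)
  have hθ0 : 0 ≤ θ := mul_nonneg (by linarith) (hvalue o)
  have hall : ∀ π' : Fin k ↪ Fin K, θ ≤ I.value G π' → ∀ π : Fin k ↪ Fin K,
      (1 - 1 / Real.exp 1) * I.value G π ≤ I.value G π' := fun π' h π =>
    (mul_le_mul_of_nonneg_left (ho π) (by linarith)).trans (hMθ.trans h)
  have hprob : 1 - Real.exp (-(72 * (K : ℝ) ^ 3)) ≤
      𝔼 ω : Fin (n ^ 2) → Choices K k n (n ^ 2),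
        if θ ≤ I.value G (π ω) then (1 : ℝ) else 0 := by
    have h := le_expect_exists (S := {ω : Choices K k n (n ^ 2) | θ ≤ trialValue I G ω})
      hsuccess (n ^ 2)
    refine (sub_le_sub_left (one_sub_pow_le hK hn) 1).trans
      (h.trans (Finset.expect_le_expect fun ω _ => ?_))
    split_ifs with h₁ h₂
    · exact le_rfl
    · obtain ⟨r, hr⟩ := h₁
      exact absurd (hr.trans (hbest ω r)) h₂
    · exact zero_le_one
    · exact le_rfl
  refine ⟨(PMF.uniformOfFintype _).map π, ?_, fun π' => ?_, ?_⟩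
  · rw [hF, PMF.map_comp, PMF.map_comp]
    congr 1
    funext ω l
    exact hπ ω l
  · rw [sum_uniform_map]
    have h₁ : θ * (1 - Real.exp (-(72 * (K : ℝ) ^ 3))) ≤ 𝔼 ω, I.value G (π ω) := by
      refine (mul_le_mul_of_nonneg_left hprob hθ0).trans ?_
      rw [Finset.mul_expect]
      refine Finset.expect_le_expect fun ω _ => ?_
      split_ifs with h
      · rwa [mul_one]
      · rw [mul_zero]; exact hvalue _
    refine le_trans ?_ h₁
    refine (mul_le_mul_of_nonneg_left (ho π') (by linarith)).trans ?_
    have h₂ := exp_le_inv hK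
    have h₃ : 1 / (16 * (K : ℝ)) = 1 / (8 * K) / 2 := by field_simp; norm_num
    have h₄ := Real.exp_pos (-(72 * (K : ℝ) ^ 3))
    have hK1 : 1 / (8 * (K : ℝ)) ≤ 1 / 8 := by
      have : (1 : ℝ) ≤ K := by exact_mod_cast hK
      exact one_div_le_one_div_of_le (by norm_num) (by linarith)
    rw [hθ, mul_right_comm]
    refine mul_le_mul_of_nonneg_right ?_ (hvalue o)
    -- With `x = 1/K`, this is `(1 - 1/e + x/8)(1 - ε) ≥ 1 - 1/e` for a failure probability `ε ≤
    -- x/16`: the loss is below `x/8` because the first factor is at most `2`.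
    nlinarith
  · rw [toOuterMeasure_uniform_map]
    have h₁ := exp_le_half_pow hK
    refine le_trans (by linarith) (hprob.trans (Finset.expect_le_expect fun ω _ => ?_))
    split_ifs with h₂ h₃
    · exact le_rfl
    · exact absurd (hall _ h₂) h₃
    · exact zero_le_one
    · exact le_rfl

end Calibration

theorem theorem4p3 :
    ∃ (A : Calibration.Program) (T : Polynomial ℕ),
      ∀ (K k m : ℕ) (_hkK : k ≤ K) (I : Calibration.Instance K k m)
        (G : (Fin m → ℝ) → (Fin m → ℝ) → ℝ) (_hG : Calibration.IsSMDR I G),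
        (∀ s ∈ (A.run (I.oracle G) I.initial).support, s.time ≤ T.eval (K + k + m)) ∧
        ∃ μ : PMF (Fin k ↪ Fin K),
          (A.run (I.oracle G) I.initial).map (Calibration.State.output k) =
            μ.map (fun π j => (π j : ℕ)) ∧
          (∀ π : Fin k ↪ Fin K,
            (1 - 1 / Real.exp 1) * I.value G π ≤ ∑ π', (μ π').toReal * I.value G π') ∧
          1 - (1 / 2 : ℝ) ^ K ≤
            (μ.toOuterMeasure {π' | ∀ π : Fin k ↪ Fin K,
              (1 - 1 / Real.exp 1) * I.value G π ≤ I.value G π'}).toReal := by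
  -- The time polynomial is the symbolic cost of the program, computed over polynomials with loop
  -- bounds expressed in `X`, which stands for `K + k + m`.
  refine ⟨Calibration.Algorithm.calibrate, Calibration.Algorithm.calibrate.cost
    (Calibration.Algorithm.loopBound Polynomial.X), fun K k m hkK I G hG => ?_⟩
  have h := Calibration.exists_distribution hkK hG
  have hT := Calibration.Program.map_cost (Polynomial.evalRingHom (K + k + m))
    (Calibration.Algorithm.loopBound Polynomial.X) Calibration.Algorithm.calibrate
  simp only [Polynomial.coe_evalRingHom, Calibration.Algorithm.eval_loopBound] at hT
  rw [hT]
  exact h
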